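/- **Setting.** Fix the number of layers $L\ge 3$, the bound $\lambda\ge 1$ on the number of tracks kept per step, and the number $b$ of bits with which a hit is recorded. An event record assigns to each layer $l\in\{0,\dots,L-1\}$ and each label $j\in\{0,\dots,n-1\}$ a hit $\mathbf m_{l,j}\in\mathbb R^3$ (encoded by $b$ bits) or no hit. A track has a Kalman state $(\mathbf p_{l|l},C_{l|l})$, $\mathbf p_{l|l}\in\mathbb R^5$, propagated by process matrices $F_l$, measurement matrices $H_l$ and noise covariances $W_l$ (positive semidefinite) and $V_l$ (positive definite). For a track that has been followed up to layer $l-1$, the predicted $\chi^2$ of a measurement $\mathbf m$ is $\chi^2_{l|l-1}(\mathbf m)=r^{T}R^{-1}r$ with $r=\mathbf m-H_lF_l\mathbf p_{l-1|l-1}$ and $R=H_l(F_lC_{l-1|l-1}F_l^T+W_l)H_l^T+V_l$. The quality score at layer $l$ is $q_l=l-m_{\rm ghost}-\omega\,\chi^2_{\le l}$, where $\omega\ge 0$, $m_{\rm ghost}$ is the number of ghost hits and $\chi^2_{\le l}$ is the sum of the $\chi^2$ values of the track. The seeds are the triplets of hits in layers $0,1,2$ that satisfy a given criterion; $k_{\rm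 seed}$ is their number. Each seed comes with given initial estimates of $\mathbf p_{2|2}$, $C_{2|2}$ and $\chi^2_{\le 2}$. Let $\chi_0^2$ be a fixed threshold. **Classical track finding.** For each seed, start with the list consisting of the seed. For $l=3,\dots,L-1$, replace each track of the list by all its extensions by a hit $\mathbf m_{l,j}$ with $\chi^2_{l|l-1}(\mathbf m_{l,j})<\chi_0^2$ (with a Kalman update), or by its extension by a ghost hit if there is no such hit; then keep the $\lambda$ tracks with the highest $q_l$, sorted by $q_l$. The output collects the final lists of all seeds. (If quality scores coincide, ties may be resolved arbitrarily; otherwise the output is unique.) **Quantum track finding.** The same procedure, but the extensions of a track at layer $l$ are found in $\lambda$ rounds. In each round, quantum minimum finding of $\chi^2_{l|l-1}$ over the hits of layer $l$ not yet used for this track is run $\lceil\log_2(3L\lambda^2n^3)\rceil$ times, and the sample with the lowest $\chi^2_{l|l-1}$ is used if it is less than $\chi_0^2$. A ghost hit is added if no round gives a new track. Quantum minimum finding, on $N=2^{\lceil\log_2 n\rceil}$ addresses (those without a hit are never marked), keeps a threshold $y$, initially $\chi_0^2$. While fewer than $22.5\sqrt N$ oracle calls have been made, it performs the steps of the exponential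 search of Boyer, Brassard, Høyer and Tapp for a hit with $\chi^2_{l|l-1}<y$: after $s$ failures since the last change of $y$, apply a uniformly random number $k<\min((6/5)^s,\sqrt N)$ of Grover iterations to the uniform superposition of all addresses, measure, and test the outcome ($k+1$ calls); if the outcome is a hit with $\chi^2_{l|l-1}<y$, remember it and set $y$ to its $\chi^2_{l|l-1}$. It returns the last remembered hit, if any. **Time** is the number of elementary quantum gates (Hadamard, $X$, $Z$, Toffoli), plus $\lceil\log_2(L N)\rceil$ for every QRAM access, plus classical steps (arithmetic operations on the data of a hit or a track count $O(1)$). **Theorem.** For all $L\ge3$, $\lambda\ge1$ and $b$ there are constants $C$ and $c$ such that, for all choices of the remaining data above, every $n$ and every event record: 1. with probability at least $1/2$, the output of quantum track finding is an output of classical track finding; 2. if $n\ge 2$, quantum track finding always takes time at most $C\,k_{\rm seed}\sqrt n\,(\log n)^{c}$, that is, $\tilde O(k_{\rm seed}\sqrt n)$. -/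

import Mathlib

open scoped Matrix ENNReal

noncomputable section

namespace QTrack

/-! ### The tracking model -/

/-- The fixed data of the experiment and of the track finder.  Hit coordinates are recorded with
fixed precision, as words of `b` bits; `pos` turns a word into a point of space.  The layers are
numbered `0, 1, 2, …`. -/
structure Model (b : ℕ) where
  /-- the point of `ℝ³` encoded by a word -/
  pos : (Fin b → Bool) → (Fin 3 → ℝ)
  /-- process matrix, from layer `l - 1` to layer `l` -/
  F : ℕ → Matrix (Fin 5) (Fin 5) ℝ
  /-- measurement matrix of layer `l` -/
  H : ℕ → Matrix (Fin 3) (Fin 5) ℝ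
  /-- covariance of the process noise -/
  W : ℕ → Matrix (Fin 5) (Fin 5) ℝ
  /-- covariance of the measurement noise -/
  V : ℕ → Matrix (Fin 3) (Fin 3) ℝ
  W_posSemidef : ∀ l, (W l).PosSemidef
  V_posDef : ∀ l, (V l).PosDef
  /-- the quality criterion for seeds -/
  good : (Fin 3 → ℝ) → (Fin 3 → ℝ) → (Fin 3 → ℝ) → Bool
  /-- estimate of the state vector at layer 2 from the three hits of a seed -/
  initState : (Fin 3 → ℝ) → (Fin 3 → ℝ) → (Fin 3 → ℝ) → (Fin 5 → ℝ)
  /-- covariance of that estimate -/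
  initCov : (Fin 3 → ℝ) → (Fin 3 → ℝ) → (Fin 3 → ℝ) → Matrix (Fin 5) (Fin 5) ℝ
  initCov_posSemidef : ∀ m₀ m₁ m₂, (initCov m₀ m₁ m₂).PosSemidef
  /-- total `χ²` of a seed -/
  initChi : (Fin 3 → ℝ) → (Fin 3 → ℝ) → (Fin 3 → ℝ) → ℝ
  /-- the threshold `χ₀²` -/
  chi0 : ℝ
  /-- the weight of `χ²` in the quality score -/
  omega : ℝ
  omega_nonneg : 0 ≤ omega

/-- An event record: the word recorded for the hit with label `j` in layer `l`, or `none` if there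
is no such hit. -/
abbrev EventRecord (n b : ℕ) := ℕ → Fin n → Option (Fin b → Bool)

/-- A candidate track together with its Kalman state. -/
structure Track (n : ℕ) where
  /-- labels of the hits, layer by layer; `none` is a ghost hit -/
  hits : List (Option (Fin n))
  /-- the filtered state vector -/
  state : Fin 5 → ℝ
  /-- the covariance of the state vector -/
  cov : Matrix (Fin 5) (Fin 5) ℝ
  /-- total `χ²` -/
  chi : ℝ
  /-- number of ghost hits -/
  ghosts : ℕ

/-- Three labels in the layers 0, 1, 2 with the words recorded there. -/
structure Seed (n b : ℕ) where
  (j₀ j₁ j₂ : Fin n)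
  (v₀ v₁ v₂ : Fin b → Bool)

variable {n b : ℕ}

/-- Seed generation: all triplets of hits in the three innermost layers that are good. -/
def seeds (D : Model b) (ev : EventRecord n b) : List (Seed n b) :=
  (List.finRange n).flatMap fun j₀ => (List.finRange n).flatMap fun j₁ =>
    (List.finRange n).filterMap fun j₂ =>
      match ev 0 j₀, ev 1 j₁, ev 2 j₂ with
      | some v₀, some v₁, some v₂ =>
        if D.good (D.pos v₀) (D.pos v₁) (D.pos v₂) then some ⟨j₀, j₁, j₂, v₀, v₁, v₂⟩ else none
      | _, _, _ => none

/-- The one-element candidate list entry of a seed. -/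
def initTrack (D : Model b) (s : Seed n b) : Track n where
  hits := [some s.j₀, some s.j₁, some s.j₂]
  state := D.initState (D.pos s.v₀) (D.pos s.v₁) (D.pos s.v₂)
  cov := D.initCov (D.pos s.v₀) (D.pos s.v₁) (D.pos s.v₂)
  chi := D.initChi (D.pos s.v₀) (D.pos s.v₁) (D.pos s.v₂)
  ghosts := 0

/-- Predicted state vector at layer `l`. -/
def predState (D : Model b) (l : ℕ) (t : Track n) : Fin 5 → ℝ := D.F l *ᵥ t.state

/-- Covariance of the predicted state vector. -/
def predCov (D : Model b) (l : ℕ) (t : Track n) : Matrix (Fin 5) (Fin 5) ℝ :=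
  D.F l * t.cov * (D.F l)ᵀ + D.W l

/-- Predicted residual of the measurement `m`. -/
def residual (D : Model b) (l : ℕ) (t : Track n) (m : Fin 3 → ℝ) : Fin 3 → ℝ :=
  m - D.H l *ᵥ predState D l t

/-- Covariance of the predicted residual. -/
def residualCov (D : Model b) (l : ℕ) (t : Track n) : Matrix (Fin 3) (Fin 3) ℝ :=
  D.H l * predCov D l t * (D.H l)ᵀ + D.V l

/-- Kalman gain. -/
def gain (D : Model b) (l : ℕ) (t : Track n) : Matrix (Fin 5) (Fin 3) ℝ :=
  predCov D l t * (D.H l)ᵀ * (residualCov D l t)⁻¹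

/-- Predicted `χ²` of the hit recorded as the word `v`. -/
def chi2 (D : Model b) (l : ℕ) (t : Track n) (v : Fin b → Bool) : ℝ :=
  residual D l t (D.pos v) ⬝ᵥ ((residualCov D l t)⁻¹ *ᵥ residual D l t (D.pos v))

/-- Append the hit with label `j` and word `v` in layer `l` and filter. -/
def addHit (D : Model b) (l : ℕ) (t : Track n) (j : Fin n) (v : Fin b → Bool) : Track n where
  hits := t.hits ++ [some j]
  state := predState D l t + gain D l t *ᵥ residual D l t (D.pos v)
  cov := (1 - gain D l t * D.H l) * predCov D l t
  chi := t.chi + chi2 D l t v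
  ghosts := t.ghosts

/-- Append a ghost hit at the predicted measurement: the residual is zero and no information is
gained. -/
def addGhost (D : Model b) (l : ℕ) (t : Track n) : Track n where
  hits := t.hits ++ [none]
  state := predState D l t
  cov := predCov D l t
  chi := t.chi
  ghosts := t.ghosts + 1

/-- Quality score of a track that has reached layer `l`. -/
def quality (D : Model b) (l : ℕ) (t : Track n) : ℝ := l - t.ghosts - D.omega * t.chi

/-- The layers `3, …, L - 1`. -/
def layers (L : ℕ) : List ℕ := List.range' 3 (L - 3)

/-! ### Classical track finding -/

/-- All extensions of `t` by hits of layer `l` with `χ² < χ₀²`. -/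
def goodExtensions (D : Model b) (ev : EventRecord n b) (l : ℕ) (t : Track n) : List (Track n) :=
  (List.finRange n).filterMap fun j =>
    match ev l j with
    | some v => if chi2 D l t v < D.chi0 then some (addHit D l t j v) else none
    | none => none

/-- The new tracks formed from `t` at layer `l`: the good extensions, or the extension by a ghost
hit if there is none. -/
def extensions (D : Model b) (ev : EventRecord n b) (l : ℕ) (t : Track n) : List (Track n) :=
  match goodExtensions D ev l t with
  | [] => [addGhost D l t]
  | ts => ts

/-- `sel` consists of the best `lam` entries of `pool` (all entries, if there are fewer), sorted by
decreasing score.  Equal scores may be resolved in any way; if the scores are distinct, then `sel`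
is determined by `pool`. -/
def IsBest (lam : ℕ) (score : Track n → ℝ) (pool sel : List (Track n)) : Prop :=
  ∃ rest, (sel ++ rest).Perm pool ∧ sel.length = min lam pool.length ∧
    sel.Pairwise (fun x y => score y ≤ score x) ∧ ∀ x ∈ sel, ∀ y ∈ rest, score y ≤ score x

/-- Track finding, started with the candidate list `cs`, can run through the given layers and end
with the candidate list `out`. -/
def Propagates (lam : ℕ) (D : Model b) (ev : EventRecord n b) :
    List ℕ → List (Track n) → List (Track n) → Prop
  | [], cs, out => out = cs
  | l :: ls, cs, out => ∃ cs', IsBest lam (quality D l) (cs.flatMap (extensions D ev l)) cs' ∧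
      Propagates lam D ev ls cs' out

/-- `out` is an output of classical track finding for the given seeds. -/
def IsOutputFor (L lam : ℕ) (D : Model b) (ev : EventRecord n b) :
    List (Seed n b) → List (Track n) → Prop
  | [], out => out = []
  | s :: ss, out => ∃ o₁ o₂, Propagates lam D ev (layers L) [initTrack D s] o₁ ∧
      IsOutputFor L lam D ev ss o₂ ∧ out = o₁ ++ o₂

/-- `out` is an output of classical track finding on the event record `ev`, for some resolution of
ties between quality scores. -/
def IsTrackFindingOutput (L lam : ℕ) (D : Model b) (ev : EventRecord n b)
    (out : List (Track n)) : Prop :=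
  IsOutputFor L lam D ev (seeds D ev) out

/-! ### Quantum circuits with QRAM -/

/-- The qubits: `q` address qubits, a memory-cell register of `b + 1` qubits (the first is a flag
telling whether there is a hit), and ancillas. -/
abbrev Wire (q b : ℕ) := Fin q ⊕ Fin (b + 1) ⊕ Fin (q + b + 2)

/-- Computational basis states. -/
abbrev Basis (q b : ℕ) := Wire q b → Bool

/-- The address qubit `i`. -/
abbrev addrW (q b : ℕ) (i : Fin q) : Wire q b := Sum.inl i

/-- The memory-cell qubit `i`. -/
abbrev cellW (q b : ℕ) (i : Fin (b + 1)) : Wire q b := Sum.inr (Sum.inl i)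

/-- The ancilla `i`. -/
abbrev ancW (q b : ℕ) (i : Fin (q + b + 2)) : Wire q b := Sum.inr (Sum.inr i)

/-- Elementary gates, and the QRAM gate. -/
inductive Gate (q b : ℕ) where
  | X (w : Wire q b)
  | Z (w : Wire q b)
  | H (w : Wire q b)
  /-- Toffoli gate with controls `w₁, w₂` and target `w₃` -/
  | CCX (w₁ w₂ w₃ : Wire q b)
  | qram

/-- Contents of the addressed memory bank. -/
abbrev Memory (q b : ℕ) := (Fin q → Bool) → (Fin (b + 1) → Bool)

variable {q : ℕ}

/-- Action of the Toffoli gate on basis states (a target that is also a control is not allowed, and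
such a gate does nothing). -/
def toffoli (w₁ w₂ w₃ : Wire q b) (x : Basis q b) : Basis q b :=
  if w₃ = w₁ ∨ w₃ = w₂ then x else Function.update x w₃ (xor (x w₃) (x w₁ && x w₂))

/-- Action of the QRAM gate on basis states: `|j⟩|x⟩ ↦ |j⟩|x ⊕ mem j⟩`. -/
def load (mem : Memory q b) (x : Basis q b) : Basis q b
  | Sum.inr (Sum.inl i) => xor (x (cellW q b i)) (mem (fun k => x (addrW q b k)) i)
  | w => x w

/-- The unitary action of a gate on state vectors. -/
def Gate.act (mem : Memory q b) : Gate q b → (Basis q b → ℂ) → (Basis q b → ℂ)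
  | .X w, ψ => fun x => ψ (Function.update x w (!x w))
  | .Z w, ψ => fun x => if x w then -ψ x else ψ x
  | .H w, ψ => fun x =>
      (ψ (Function.update x w false) + (if x w then -1 else 1) * ψ (Function.update x w true)) /
        (Real.sqrt 2 : ℂ)
  | .CCX w₁ w₂ w₃, ψ => fun x => ψ (toffoli w₁ w₂ w₃ x)
  | .qram, ψ => fun x => ψ (load mem x)

/-- Time of one access to a memory of `L` banks of `2 ^ q` cells: the logarithm of the number of
cells. -/
def accessTime (L q : ℕ) : ℕ := Nat.clog 2 (L * 2 ^ q)

/-- Every elementary gate counts one, a QRAM gate counts `accessTime`. -/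
def Gate.time (L : ℕ) : Gate q b → ℕ
  | .qram => accessTime L q
  | _ => 1

/-- The gates of a circuit, in the order in which they are applied. -/
abbrev Circuit (q b : ℕ) := List (Gate q b)

def Circuit.time (L : ℕ) (c : Circuit q b) : ℕ := (c.map (Gate.time L)).sum

/-- The state vector produced by a circuit from the all-zero state. -/
def Circuit.final (mem : Memory q b) (c : Circuit q b) : Basis q b → ℂ :=
  c.foldl (fun ψ g => g.act mem ψ) (fun x => if x = fun _ => false then 1 else 0)

theorem toffoli_involutive (w₁ w₂ w₃ : Wire q b) : Function.Involutive (toffoli w₁ w₂ w₃) := by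
  intro x
  unfold toffoli
  split_ifs with h
  · rfl
  · have h₁ : w₁ ≠ w₃ := fun e => h (Or.inl e.symm)
    have h₂ : w₂ ≠ w₃ := fun e => h (Or.inr e.symm)
    funext w
    by_cases hw : w = w₃
    · subst hw
      simp [Function.update_of_ne h₁, Function.update_of_ne h₂]
    · simp [Function.update_of_ne hw]

theorem load_involutive (mem : Memory q b) : Function.Involutive (load mem) := by
  intro x
  funext w
  rcases w with i | i | i <;> simp [load]

theorem flip_involutive (w : Wire q b) :
    Function.Involutive (fun x : Basis q b => Function.update x w (!x w)) := by
  intro x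
  simp

theorem Gate.norm_act (mem : Memory q b) (g : Gate q b) (ψ : Basis q b → ℂ) :
    ∑ x, ‖g.act mem ψ x‖ ^ 2 = ∑ x, ‖ψ x‖ ^ 2 := by
  cases g with
  | X w => exact Equiv.sum_comp (flip_involutive w).toPerm (fun x => ‖ψ x‖ ^ 2)
  | Z w =>
    refine Finset.sum_congr rfl fun x _ => ?_
    simp only [Gate.act]
    split_ifs <;> simp
  | CCX w₁ w₂ w₃ =>
    exact Equiv.sum_comp (toffoli_involutive w₁ w₂ w₃).toPerm (fun x => ‖ψ x‖ ^ 2)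
  | qram => exact Equiv.sum_comp (load_involutive mem).toPerm (fun x => ‖ψ x‖ ^ 2)
  | H w =>
    have key : ∀ f : Basis q b → ℝ,
        ∑ x, (f x + f (Function.update x w (!x w))) = 2 * ∑ x, f x := by
      intro f
      have := Equiv.sum_comp (flip_involutive w).toPerm f
      rw [Finset.sum_add_distrib]
      have h2 : ∑ x, f (Function.update x w (!x w)) = ∑ x, f x := this
      rw [h2]; ring
    have hs : ‖(Real.sqrt 2 : ℂ)‖ ^ 2 = 2 := by
      rw [Complex.norm_real, Real.norm_eq_abs, sq_abs]
      norm_num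
    have par : ∀ u v : ℂ, ‖(u + v) / (Real.sqrt 2 : ℂ)‖ ^ 2 + ‖(u - v) / (Real.sqrt 2 : ℂ)‖ ^ 2
        = ‖u‖ ^ 2 + ‖v‖ ^ 2 := by
      intro u v
      rw [norm_div, norm_div, div_pow, div_pow, hs]
      have := parallelogram_law_with_norm ℝ u v
      nlinarith
    have e := key (fun x => ‖(Gate.H w).act mem ψ x‖ ^ 2)
    have e' := key (fun x => ‖ψ x‖ ^ 2)
    have : ∀ x : Basis q b, ‖(Gate.H w).act mem ψ x‖ ^ 2 +
        ‖(Gate.H w).act mem ψ (Function.update x w (!x w))‖ ^ 2 =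
        ‖ψ x‖ ^ 2 + ‖ψ (Function.update x w (!x w))‖ ^ 2 := by
      intro x
      cases hx : x w
      · have hu : Function.update x w false = x := by rw [← hx]; simp
        have := par (ψ x) (ψ (Function.update x w true))
        simp only [Gate.act, hx, hu, Function.update_idem, Function.update_self, Bool.not_false]
        simpa [sub_eq_add_neg] using this
      · have hu : Function.update x w true = x := by rw [← hx]; simp
        have := par (ψ (Function.update x w false)) (ψ x)
        simp only [Gate.act, hx, hu, Function.update_idem, Function.update_self, Bool.not_true]
        simp only [sub_eq_add_neg] at this
        simp only [if_true, neg_one_mul, one_mul, Bool.false_eq_true, if_false]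
        linarith
    have t := Finset.sum_congr (rfl : (Finset.univ : Finset (Basis q b)) = _) (fun x _ => this x)
    linarith

theorem Circuit.norm_final (mem : Memory q b) (c : Circuit q b) :
    ∑ x, ‖c.final mem x‖ ^ 2 = 1 := by
  have aux : ∀ (c : Circuit q b) (ψ : Basis q b → ℂ),
      ∑ x, ‖c.foldl (fun ψ g => g.act mem ψ) ψ x‖ ^ 2 = ∑ x, ‖ψ x‖ ^ 2 := by
    intro c
    induction c with
    | nil => intro ψ; rfl
    | cons g c ih => intro ψ; rw [List.foldl_cons, ih, Gate.norm_act]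
  unfold Circuit.final
  rw [aux, Finset.sum_eq_single (fun _ => false)]
  · simp
  · intro x _ hx; simp [hx]
  · simp

/-- Run a circuit on the all-zero state and measure the address register in the computational
basis (Born rule). -/
def Circuit.measure (mem : Memory q b) (c : Circuit q b) : PMF (Fin q → Bool) :=
  (PMF.ofFintype (fun x => ENNReal.ofReal (‖c.final mem x‖ ^ 2)) (by
    rw [← ENNReal.ofReal_sum_of_nonneg (fun _ _ => by positivity), Circuit.norm_final]
    simp)).map fun x k => x (addrW q b k)

/-! ### Grover iterations as circuits -/

/-- Flip the phase if `w` and all wires of the list are `1`, by a ladder of Toffoli gates whose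
targets are the given clean ancillas, which are returned clean. -/
def ladder (w : Wire q b) : List (Wire q b) → List (Wire q b) → Circuit q b
  | [], _ => [.Z w]
  | u :: us, a :: as => [.CCX w u a] ++ ladder a us as ++ [.CCX w u a]
  | _ :: _, [] => []

/-- Flip the phase of the basis states in which every listed wire has the listed value. -/
def phaseFlip (pattern : List (Wire q b × Bool)) : Circuit q b :=
  let flips : Circuit q b := (pattern.filter fun p => !p.2).map fun p => .X p.1
  let one : Wire q b := ancW q b 0
  flips ++ [.X one] ++
    ladder one (pattern.map Prod.fst) ((List.finRange (q + b + 1)).map fun i => ancW q b i.succ) ++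
    [.X one] ++ flips

/-- Hadamard gates on all address qubits. -/
def hadamards (q b : ℕ) : Circuit q b := (List.finRange q).map fun i => .H (addrW q b i)

/-- Flip the phase of the addresses whose memory cell is in `marked`: load the cell, flip the phase
of every marked value, and unload the cell. -/
def oracle (q : ℕ) (marked : Finset (Fin (b + 1) → Bool)) : Circuit q b :=
  [.qram] ++
    (marked.toList.flatMap fun v =>
      phaseFlip ((List.finRange (b + 1)).map fun i => (cellW q b i, v i))) ++
    [.qram]

/-- Reflection about the uniform superposition of all addresses (up to a global phase). -/
def diffusion (q b : ℕ) : Circuit q b :=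
  hadamards q b ++ phaseFlip ((List.finRange q).map fun i => (addrW q b i, false)) ++ hadamards q b

/-- Prepare the uniform superposition of all addresses and apply `k` Grover iterations. -/
def grover (q : ℕ) (marked : Finset (Fin (b + 1) → Bool)) (k : ℕ) : Circuit q b :=
  hadamards q b ++ (List.replicate k (oracle q marked ++ diffusion q b)).flatten

/-! ### Randomized programs with a running time -/

/-- The joint distribution of the result and the running time of a randomized program. -/
def Run (α : Type) := PMF (α × ℕ)

instance : Monad Run where
  pure a := PMF.pure (a, 0)
  bind x f := PMF.bind x fun r => PMF.map (fun s => (s.1, r.2 + s.2)) (f r.1)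

/-- Spend `k` units of time. -/
def tick (k : ℕ) : Run Unit := PMF.pure ((), k)

/-- A uniformly random element of `{0, …, k - 1}` (for `k ≥ 1`), in time `c`. -/
def uniform (k c : ℕ) : Run ℕ :=
  PMF.map (fun i : Fin (k - 1 + 1) => ((i : ℕ), c)) (PMF.uniformOfFintype (Fin (k - 1 + 1)))

/-- Run a circuit and measure the address register; the time is that of the circuit. -/
def runCircuit (L : ℕ) (mem : Memory q b) (c : Circuit q b) : Run (Fin q → Bool) :=
  PMF.map (fun a => (a, c.time L)) (c.measure mem)

/-! ### Quantum track finding -/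

/-- Number of address qubits for `n` labels; the labels are padded to a power of two. -/
def addrBits (n : ℕ) : ℕ := Nat.clog 2 n

/-- The contents of the memory cell with address `a` in layer `l`, with its label.  There is no hit
at an address that is not the label of one, or whose hit has already been used. -/
def hitAt (ev : EventRecord n b) (l : ℕ) (used : List (Fin n)) (a : Fin (addrBits n) → Bool) :
    Option (Fin n × (Fin b → Bool)) :=
  if h : Nat.ofBits a < n then
    if (⟨Nat.ofBits a, h⟩ : Fin n) ∈ used then none
    else (ev l ⟨Nat.ofBits a, h⟩).map fun v => (⟨Nat.ofBits a, h⟩, v)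
  else none

/-- The memory bank of layer `l` as bits: a flag followed by the word of the hit. -/
def memory (ev : EventRecord n b) (l : ℕ) (used : List (Fin n)) : Memory (addrBits n) b :=
  fun a => match hitAt ev l used a with
    | some h => Fin.cons true h.2
    | none => fun _ => false

/-- The cell values that hold a hit with `χ² < y`. -/
def markedCells (D : Model b) (l : ℕ) (t : Track n) (y : ℝ) : Finset (Fin (b + 1) → Bool) :=
  {c | c 0 = true ∧ chi2 D l t (Fin.tail c) < y}

/-- Quantum minimum finding goes on while fewer than `22.5 √N` oracle calls have been made, where
`N` is the number of addresses; for an integer this is the same as being less than the ceiling. -/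
def callLimit (n : ℕ) : ℕ := ⌈22.5 * Real.sqrt (2 ^ addrBits n)⌉₊

/-- The loop of quantum minimum finding.  `calls` is the number of oracle calls made so far, `y` the
current threshold, `best` the hit it belongs to, and `s` the number of failed attempts of the
current exponential search: the next attempt makes a random number of Grover iterations less than
`min ((6/5) ^ s) √N`, measures, and tests the outcome, the test counting as one more call. -/
def minimumLoop (L : ℕ) (D : Model b) (ev : EventRecord n b) (l : ℕ) (t : Track n)
    (used : List (Fin n)) (calls s : ℕ) (y : ℝ) (best : Option (Fin n × (Fin b → Bool))) :
    Run (Option (Fin n × (Fin b → Bool))) :=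
  if _h : calls < callLimit n then do
    let k ← uniform ⌈min ((6 / 5 : ℝ) ^ s) (Real.sqrt (2 ^ addrBits n))⌉₊ (addrBits n + 1)
    let a ← runCircuit L (memory ev l used) (grover (addrBits n) (markedCells D l t y) k)
    tick (accessTime L (addrBits n) + 1)
    match hitAt ev l used a with
    | some hit =>
      if chi2 D l t hit.2 < y then
        minimumLoop L D ev l t used (calls + k + 1) 0 (chi2 D l t hit.2) (some hit)
      else minimumLoop L D ev l t used (calls + k + 1) (s + 1) y best
    | none => minimumLoop L D ev l t used (calls + k + 1) (s + 1) y best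
  else pure best
termination_by callLimit n - calls

/-- Quantum minimum finding: look for the unused hit of layer `l` with the lowest `χ²`, among those
with `χ² < χ₀²`; `none` means that no good measurement was found. -/
def minimumFinding (L : ℕ) (D : Model b) (ev : EventRecord n b) (l : ℕ) (t : Track n)
    (used : List (Fin n)) : Run (Option (Fin n × (Fin b → Bool))) :=
  minimumLoop L D ev l t used 0 0 D.chi0 none

/-- The one of two samples with the lower `χ²`. -/
def better (D : Model b) (l : ℕ) (t : Track n) :
    Option (Fin n × (Fin b → Bool)) → Option (Fin n × (Fin b → Bool)) →
      Option (Fin n × (Fin b → Bool))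
  | some h, some h' => if chi2 D l t h'.2 < chi2 D l t h.2 then some h' else some h
  | some h, none => some h
  | none, r => r

/-- Repeat quantum minimum finding and select the sample with the lowest `χ²`. -/
def repeatedMinimum (L : ℕ) (D : Model b) (ev : EventRecord n b) (l : ℕ) (t : Track n)
    (used : List (Fin n)) : ℕ → Run (Option (Fin n × (Fin b → Bool)))
  | 0 => pure none
  | k + 1 => do
    let r ← minimumFinding L D ev l t used
    let r' ← repeatedMinimum L D ev l t used k
    tick 1
    pure (better D l t r r')

/-- `log (3 L λ² n³)`, rounded up. -/
def repetitions (L lam n : ℕ) : ℕ := Nat.clog 2 (3 * L * lam ^ 2 * n ^ 3)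

/-- The given number of rounds in which new tracks are formed from the track `t`.  A hit that has
been found is erased from the memory for the remaining rounds, so that it is not found again. -/
def rounds (L lam : ℕ) (D : Model b) (ev : EventRecord n b) (l : ℕ) (t : Track n) :
    ℕ → List (Fin n) → Run (List (Track n))
  | 0, _ => pure []
  | i + 1, used => do
    let r ← repeatedMinimum L D ev l t used (repetitions L lam n)
    tick 1
    match r with
    | some h =>
      -- erasing the hit and restoring it in the end; copying the track and filtering
      tick (2 * accessTime L (addrBits n) + L)
      let ts ← rounds L lam D ev l t i (h.1 :: used)
      if chi2 D l t h.2 < D.chi0 then pure (addHit D l t h.1 h.2 :: ts) else pure ts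
    | none => rounds L lam D ev l t i used

/-- The new tracks formed from the track `t` at layer `l`. -/
def quantumExtensions (L lam : ℕ) (D : Model b) (ev : EventRecord n b) (l : ℕ) (t : Track n) :
    Run (List (Track n)) := do
  tick 1
  let ts ← rounds L lam D ev l t lam []
  match ts with
  | [] => do
    tick L
    pure [addGhost D l t]
  | ts => pure ts

/-- The new tracks formed at layer `l` from all tracks of the candidate list. -/
def quantumPool (L lam : ℕ) (D : Model b) (ev : EventRecord n b) (l : ℕ) :
    List (Track n) → Run (List (Track n))
  | [] => pure []
  | t :: ts => do
    let us ← quantumExtensions L lam D ev l t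
    let vs ← quantumPool L lam D ev l ts
    pure (us ++ vs)

/-- Sort by quality and keep the best `lam` tracks. -/
def selectBest (lam : ℕ) (D : Model b) (l : ℕ) (pool : List (Track n)) : List (Track n) :=
  (pool.mergeSort fun t u => decide (quality D l u ≤ quality D l t)).take lam

/-- Propagate a candidate list through the given layers. -/
def quantumPropagate (L lam : ℕ) (D : Model b) (ev : EventRecord n b) :
    List ℕ → List (Track n) → Run (List (Track n))
  | [], cs => pure cs
  | l :: ls, cs => do
    let pool ← quantumPool L lam D ev l cs
    tick (pool.length ^ 2 + 1)
    quantumPropagate L lam D ev ls (selectBest lam D l pool)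

/-- Quantum track finding for the given seeds. -/
def quantumFindFor (L lam : ℕ) (D : Model b) (ev : EventRecord n b) :
    List (Seed n b) → Run (List (Track n))
  | [] => pure []
  | s :: ss => do
    tick 1
    let o₁ ← quantumPropagate L lam D ev (layers L) [initTrack D s]
    tick o₁.length
    let o₂ ← quantumFindFor L lam D ev ss
    pure (o₁ ++ o₂)

/-- Quantum track finding on an event record: the joint distribution of the output and of the
running time. -/
def quantumTrackFinding (L lam : ℕ) (D : Model b) (ev : EventRecord n b) :
    PMF (List (Track n) × ℕ) :=
  quantumFindFor L lam D ev (seeds D ev)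

end QTrack

end

/-! Let N be the number of addresses and t the number of marked ones. On state vectors whose qubits
outside the address register are 0, the circuits realise Grover's algorithm exactly. If sin θ =
√(t/N), then after k iterations every marked address is measured with probability sin²((2k+1)θ)/t
(`measure_grover`).

Averaged over the random k < M, an attempt fails with probability at most 1/2 + 1/(4M sin 2θ). A
potential function in the bound on M turns this into at most (45/8)√(N/t) expected calls until a
marked hit appears (`exists_searchCost`). The hit found is uniform among the marked ones, so its
rank is uniform, and ties only help. Hence the expected number E_t of calls until the minimum is
reached obeys E_t ≤ (45/8)√(N/t) + average of E_j over j < t, which is solved by E_t ≤ (45/8)√N(2 -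
1/√t) ≤ (45/4)√N (`minimumCost_average`). The limit 22.5√N is twice this, so by Markov's inequality
one run misses the minimum with probability at most 1/2 (`failure_minimumFinding_le`), and the best
of r runs with probability at most 2^(-r) (`failure_repeatedMinimum_le`).

If all these minima are correct, the λ rounds list the good hits of a track in order of χ², so every
extension left out is dominated by λ extensions that were found. This relation, `TopPart`, survives
concatenation over the tracks, and sorting and truncating the part found is a legitimate classical
selection from the full pool (`TopPart.isBest_selectBest`). A union bound over at most n³ seeds, L
layers, λ tracks and λ rounds, with 2^r ≥ 3Lλ²n³, leaves a total failure probability of at most 1/3.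

The time bound holds for every outcome. A run makes O(√N) calls with N ≤ 2n, since only its last
attempt can exceed the limit, and by at most ⌈√N⌉. For fixed L and b the work per call is O(log n).
The O(log n) repetitions give the second logarithm; all other loops contribute constants. -/

namespace QTrack

variable {q b : ℕ}

/-! ### The action of circuits on state vectors -/

/-- The action of a circuit on state vectors. -/
noncomputable def Circuit.act (mem : Memory q b) (c : Circuit q b) (ψ : Basis q b → ℂ) : Basis q b → ℂ :=
  c.foldl (fun ψ g => g.act mem ψ) ψ

theorem Circuit.act_cons (mem : Memory q b) (g : Gate q b) (c : Circuit q b)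
    (ψ : Basis q b → ℂ) :
    Circuit.act mem (g :: c) ψ = Circuit.act mem c (g.act mem ψ) := rfl

theorem Circuit.act_append (mem : Memory q b) (c d : Circuit q b) (ψ : Basis q b → ℂ) :
    Circuit.act mem (c ++ d) ψ = Circuit.act mem d (Circuit.act mem c ψ) := by
  simp [Circuit.act, List.foldl_append]

theorem Circuit.act_singleton (mem : Memory q b) (g : Gate q b) (ψ : Basis q b → ℂ) :
    Circuit.act mem [g] ψ = g.act mem ψ := rfl

/-! ### Ladders and phase flips -/

/-- On state vectors with clean ancillas a ladder is a phase flip. -/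
theorem act_ladder (mem : Memory q b) (us : List (Wire q b)) :
    ∀ (w : Wire q b) (as : List (Wire q b)) (ψ : Basis q b → ℂ),
      us.length ≤ as.length → as.Nodup → w ∉ as → (∀ u ∈ us, u ∉ as) →
      (∀ x, ψ x ≠ 0 → ∀ a ∈ as, x a = false) →
      Circuit.act mem (ladder w us as) ψ =
        fun x => if x w = true ∧ ∀ u ∈ us, x u = true then -ψ x else ψ x := by
  induction us with
  | nil =>
    intro w as ψ _ _ _ _ _
    funext x
    simp [ladder, Circuit.act, Gate.act]
  | cons u us ih =>
    intro w as ψ hlen hnd hw hus hψ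
    cases as with
    | nil => simp at hlen
    | cons a as =>
      have hwa : w ≠ a := fun e => hw (by simp [e])
      have hua : u ≠ a := fun e => hus u (by simp) (by simp [e])
      have hane : ¬ (a = w ∨ a = u) := by
        rintro (e | e)
        · exact hwa e.symm
        · exact hua e.symm
      rw [List.nodup_cons] at hnd
      have htof : ∀ x : Basis q b, toffoli w u a x = Function.update x a (xor (x a) (x w && x u)) :=
        fun x => by simp only [toffoli, if_neg hane]
      have htv : ∀ (x : Basis q b) v, v ≠ a → toffoli w u a x v = x v := fun x v hv => by
        rw [htof, Function.update_of_ne hv]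
      -- After the first Toffoli gate the ancilla `a` carries the conjunction of `w` and `u` and
      -- becomes the top of the remaining ladder, whose ancillas are still clean.
      have h1 := ih a as ((Gate.CCX w u a).act mem ψ) (by simpa using hlen) hnd.2 hnd.1
        (fun v hv hva => hus v (by simp [hv]) (by simp [hva]))
        (fun x hx c hc => by
          have := hψ _ hx c (by simp [hc])
          rwa [htv x c (fun e => hnd.1 (e ▸ hc))] at this)
      simp only [ladder, Circuit.act_append, Circuit.act_singleton]
      rw [h1]
      funext x
      have hinv : toffoli w u a (toffoli w u a x) = x := toffoli_involutive w u a x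
      simp only [Gate.act, hinv]
      by_cases h0 : ψ x = 0
      · simp [h0]
      · have hxa : x a = false := hψ x h0 a (by simp)
        have e1 : toffoli w u a x a = (x w && x u) := by rw [htof]; simp [hxa]
        have e2 : (∀ v ∈ us, toffoli w u a x v = true) ↔ ∀ v ∈ us, x v = true := by
          refine forall₂_congr fun v hv => ?_
          rw [htv x v (fun e => hus v (by simp [hv]) (by simp [e]))]
        refine if_congr ?_ rfl rfl
        rw [e1, e2, List.forall_mem_cons, Bool.and_eq_true, and_assoc]

open Classical in
/-- Flip the bits on a list of wires. -/
noncomputable def flipWires (ws : List (Wire q b)) (x : Basis q b) : Basis q b :=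
  fun v => if v ∈ ws then !x v else x v

theorem flipWires_involutive (ws : List (Wire q b)) : Function.Involutive (flipWires ws) := by
  intro x
  funext v
  simp only [flipWires]
  split_ifs <;> simp

theorem act_map_X (mem : Memory q b) (ws : List (Wire q b)) (hnd : ws.Nodup) :
    ∀ ψ : Basis q b → ℂ,
      Circuit.act mem (ws.map fun w => Gate.X w) ψ = fun x => ψ (flipWires ws x) := by
  induction ws with
  | nil =>
    intro ψ
    funext x
    have : flipWires [] x = x := by
      funext v
      exact if_neg List.not_mem_nil
    rw [this]
    rfl
  | cons w ws ih =>
    intro ψ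
    rw [List.nodup_cons] at hnd
    rw [List.map_cons, Circuit.act_cons, ih hnd.2]
    funext x
    simp only [Gate.act]
    congr 1
    funext v
    by_cases hv : v = w
    · subst hv; simp [flipWires, hnd.1]
    · simp only [flipWires, Function.update_of_ne hv]
      by_cases hm : v ∈ ws
      · rw [if_pos hm, if_pos (List.mem_cons_of_mem _ hm)]
      · rw [if_neg hm, if_neg (by rw [List.mem_cons]; tauto)]

/-- Conjugation by `X` on the wires with prescribed value 0 turns the pattern into all ones. The
ancilla set to 1 is the top of the ladder, so that the empty pattern needs no special treatment. -/
theorem act_phaseFlip (mem : Memory q b) (pattern : List (Wire q b × Bool))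
    (hnd : (pattern.map Prod.fst).Nodup) (hlen : pattern.length ≤ q + b + 1)
    (hanc : ∀ p ∈ pattern, ∀ i, p.1 ≠ ancW q b i) (ψ : Basis q b → ℂ)
    (hψ : ∀ x, ψ x ≠ 0 → ∀ i, x (ancW q b i) = false) :
    Circuit.act mem (phaseFlip pattern) ψ =
      fun x => if ∀ p ∈ pattern, x p.1 = p.2 then -ψ x else ψ x := by
  set ws := ((pattern.filter fun p => !p.2).map Prod.fst) with hws
  have hflips : ((pattern.filter fun p => !p.2).map fun p => (Gate.X p.1 : Gate q b)) =
      ws.map fun w => Gate.X w := by simp [hws]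
  have hwnd : ws.Nodup := hnd.sublist (List.filter_sublist.map _)
  have hwanc : ∀ i, ancW q b i ∉ ws := by
    intro i hi
    obtain ⟨p, hp, e⟩ := List.mem_map.1 hi
    exact hanc p (List.mem_filter.1 hp).1 i e
  have hmem : ∀ p ∈ pattern, (p.1 ∈ ws ↔ p.2 = false) := by
    intro p hp
    constructor
    · intro h
      obtain ⟨p', hp', e⟩ := List.mem_map.1 h
      have hp'' := List.mem_filter.1 hp'
      have : p' = p := List.inj_on_of_nodup_map hnd hp''.1 hp e
      subst this
      simpa using hp''.2
    · intro h
      exact List.mem_map.2 ⟨p, List.mem_filter.2 ⟨hp, by simp [h]⟩, rfl⟩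
  set one := ancW q b 0 with hone
  have hX : Circuit.act mem [Gate.X one] = fun ψ x => ψ (Function.update x one (!x one)) := rfl
  unfold phaseFlip
  simp only [hflips, Circuit.act_append, act_map_X mem ws hwnd, ← hone, hX]
  rw [act_ladder]
  · funext x
    set x' := Function.update (flipWires ws x) one (!(flipWires ws x) one) with hx'
    have hback : flipWires ws (Function.update x' one (!x' one)) = x := by
      have : Function.update x' one (!x' one) = flipWires ws x := by
        rw [hx']; simp
      rw [this, flipWires_involutive]
    simp only [hback]
    by_cases h0 : ψ x = 0
    · simp [h0]
    have e1 : x' one = true := by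
      rw [hx']
      simp only [Function.update_self, flipWires, if_neg (hwanc 0), hone]
      simp [hψ x h0 0]
    have e2 : (∀ u ∈ pattern.map Prod.fst, x' u = true) ↔ ∀ p ∈ pattern, x p.1 = p.2 := by
      simp only [List.mem_map, forall_exists_index, and_imp, forall_apply_eq_imp_iff₂]
      refine forall₂_congr fun p hp => ?_
      have hp1 : p.1 ≠ one := hanc p hp 0
      rw [hx', Function.update_of_ne hp1]
      simp only [flipWires]
      rcases hb : p.2 with _ | _
      · rw [if_pos ((hmem p hp).2 hb)]; simp
      · rw [if_neg (fun h => by rw [(hmem p hp).1 h] at hb; exact absurd hb (by simp))]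
    simp only [e1, e2, true_and]
  · simpa using hlen
  · refine (List.nodup_finRange _).map fun i j h => ?_
    simpa using h
  · intro h
    obtain ⟨i, _, e⟩ := List.mem_map.1 h
    simp [hone] at e
  · intro u hu h
    obtain ⟨p, hp, rfl⟩ := List.mem_map.1 hu
    obtain ⟨i, _, e⟩ := List.mem_map.1 h
    exact hanc p hp _ e.symm
  · intro x hx a ha
    obtain ⟨i, _, rfl⟩ := List.mem_map.1 ha
    have := hψ _ hx i.succ
    simp only [flipWires, if_neg (hwanc _)] at this
    rwa [Function.update_of_ne (by simp [hone])] at this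

/-! ### Hadamard gates -/

/-- Flip one bit. -/
def flipBit (w : Wire q b) (x : Basis q b) : Basis q b := Function.update x w (!x w)

/-- The sign of a bit. -/
def bitSign (w : Wire q b) (x : Basis q b) : ℂ := if x w then -1 else 1

theorem flipBit_flipBit (w : Wire q b) (x : Basis q b) : flipBit w (flipBit w x) = x :=
  flip_involutive w x

theorem flipBit_of_ne {w v : Wire q b} (h : v ≠ w) (x : Basis q b) : flipBit w x v = x v := by
  simp [flipBit, h]

theorem flipBit_comm (w v : Wire q b) (x : Basis q b) :
    flipBit w (flipBit v x) = flipBit v (flipBit w x) := by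
  funext u
  by_cases h : w = v
  · rw [h]
  · have h' : v ≠ w := Ne.symm h
    by_cases hu : u = w
    · subst hu; simp [flipBit, h]
    · by_cases hv : u = v
      · subst hv; simp [flipBit, h']
      · simp [flipBit, hu, hv]

theorem bitSign_flipBit_self (w : Wire q b) (x : Basis q b) :
    bitSign w (flipBit w x) = -bitSign w x := by
  simp only [bitSign, flipBit, Function.update_self]
  cases x w <;> simp

theorem bitSign_flipBit_of_ne {w v : Wire q b} (h : v ≠ w) (x : Basis q b) :
    bitSign v (flipBit w x) = bitSign v x := by
  simp [bitSign, flipBit_of_ne h]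

theorem bitSign_mul_self (w : Wire q b) (x : Basis q b) : bitSign w x * bitSign w x = 1 := by
  simp only [bitSign]; split_ifs <;> simp

theorem ofReal_sqrt_two_mul_self : (Real.sqrt 2 : ℂ) * (Real.sqrt 2 : ℂ) = 2 := by
  rw [← Complex.ofReal_mul, Real.mul_self_sqrt (by norm_num)]; norm_num

theorem ofReal_sqrt_two_ne_zero : (Real.sqrt 2 : ℂ) ≠ 0 := by
  intro h
  have := ofReal_sqrt_two_mul_self
  rw [h] at this
  norm_num at this

/-- The action of a Hadamard gate. -/
noncomputable def hadamardAct (w : Wire q b) (ψ : Basis q b → ℂ) : Basis q b → ℂ :=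
  fun x => (bitSign w x * ψ x + ψ (flipBit w x)) / (Real.sqrt 2 : ℂ)

theorem act_H (mem : Memory q b) (w : Wire q b) (ψ : Basis q b → ℂ) :
    (Gate.H w).act mem ψ = hadamardAct w ψ := by
  funext x
  simp only [Gate.act, hadamardAct, bitSign, flipBit]
  cases hx : x w
  · have hu : Function.update x w false = x := by rw [← hx]; simp
    simp [hu]
  · have hu : Function.update x w true = x := by rw [← hx]; simp
    simp [hu, add_comm]

theorem hadamardAct_hadamardAct (w : Wire q b) (ψ : Basis q b → ℂ) :
    hadamardAct w (hadamardAct w ψ) = ψ := by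
  funext x
  simp only [hadamardAct, bitSign_flipBit_self, flipBit_flipBit]
  have h := ofReal_sqrt_two_mul_self
  have h0 := ofReal_sqrt_two_ne_zero
  have h2 := bitSign_mul_self w x
  field_simp
  rw [sq, h]
  linear_combination ψ x * h2

theorem hadamardAct_comm (w v : Wire q b) (ψ : Basis q b → ℂ) :
    hadamardAct w (hadamardAct v ψ) = hadamardAct v (hadamardAct w ψ) := by
  by_cases h : w = v
  · rw [h]
  · funext x
    have h0 := ofReal_sqrt_two_ne_zero
    simp only [hadamardAct, bitSign_flipBit_of_ne h, bitSign_flipBit_of_ne (Ne.symm h),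
      flipBit_comm v w]
    field_simp
    ring

/-- Hadamard gates are symmetric for the bilinear pairing. Together with the involution property
this lets the amplitude at the zero state be read off as a pairing with the uniform vector. -/
theorem sum_mul_hadamardAct (w : Wire q b) (φ ψ : Basis q b → ℂ) :
    ∑ x, φ x * hadamardAct w ψ x = ∑ x, hadamardAct w φ x * ψ x := by
  have key : ∑ x, φ x * ψ (flipBit w x) = ∑ x, φ (flipBit w x) * ψ x := by
    have := Equiv.sum_comp (flip_involutive w).toPerm (fun x => φ (flipBit w x) * ψ x)
    rw [← this]
    refine Finset.sum_congr rfl fun x _ => ?_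
    change _ = φ (flipBit w (flipBit w x)) * ψ (flipBit w x)
    rw [flipBit_flipBit]
  have e1 : ∑ x, φ x * hadamardAct w ψ x =
      (∑ x, φ x * (bitSign w x * ψ x) + ∑ x, φ x * ψ (flipBit w x)) / (Real.sqrt 2 : ℂ) := by
    rw [← Finset.sum_add_distrib, Finset.sum_div]
    exact Finset.sum_congr rfl fun x _ => by simp only [hadamardAct]; ring
  have e2 : ∑ x, hadamardAct w φ x * ψ x =
      (∑ x, φ x * (bitSign w x * ψ x) + ∑ x, φ (flipBit w x) * ψ x) / (Real.sqrt 2 : ℂ) := by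
    rw [← Finset.sum_add_distrib, Finset.sum_div]
    exact Finset.sum_congr rfl fun x _ => by simp only [hadamardAct]; ring
  rw [e1, e2, key]

theorem hadamardAct_sub_smul (w : Wire q b) (φ ψ : Basis q b → ℂ) (c : ℂ) :
    hadamardAct w (fun x => ψ x - c * φ x) =
      fun x => hadamardAct w ψ x - c * hadamardAct w φ x := by
  funext x
  simp only [hadamardAct]
  ring

/-- The action of Hadamard gates on a list of wires. -/
noncomputable def hadamardsAct (ws : List (Wire q b)) (ψ : Basis q b → ℂ) : Basis q b → ℂ :=
  ws.foldl (fun ψ w => hadamardAct w ψ) ψ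

theorem hadamardsAct_cons (w : Wire q b) (ws : List (Wire q b)) (ψ : Basis q b → ℂ) :
    hadamardsAct (w :: ws) ψ = hadamardsAct ws (hadamardAct w ψ) := rfl

theorem hadamardsAct_append (ws vs : List (Wire q b)) (ψ : Basis q b → ℂ) :
    hadamardsAct (ws ++ vs) ψ = hadamardsAct vs (hadamardsAct ws ψ) := by
  simp [hadamardsAct, List.foldl_append]

theorem hadamardAct_hadamardsAct (w : Wire q b) (ws : List (Wire q b)) :
    ∀ ψ : Basis q b → ℂ,
      hadamardAct w (hadamardsAct ws ψ) = hadamardsAct ws (hadamardAct w ψ) := by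
  induction ws with
  | nil => intro ψ; rfl
  | cons v ws ih =>
    intro ψ
    rw [hadamardsAct_cons, hadamardsAct_cons, ih, hadamardAct_comm]

theorem hadamardsAct_hadamardsAct (ws : List (Wire q b)) :
    ∀ ψ : Basis q b → ℂ, hadamardsAct ws (hadamardsAct ws ψ) = ψ := by
  induction ws with
  | nil => intro ψ; rfl
  | cons w ws ih =>
    intro ψ
    rw [hadamardsAct_cons, hadamardsAct_cons, hadamardAct_hadamardsAct, ih,
      hadamardAct_hadamardAct]

theorem hadamardsAct_sub_smul (ws : List (Wire q b)) (c : ℂ) :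
    ∀ φ ψ : Basis q b → ℂ, hadamardsAct ws (fun x => ψ x - c * φ x) =
      fun x => hadamardsAct ws ψ x - c * hadamardsAct ws φ x := by
  induction ws with
  | nil => intro φ ψ; rfl
  | cons w ws ih =>
    intro φ ψ
    simp only [hadamardsAct_cons, hadamardAct_sub_smul, ih]

theorem sum_mul_hadamardsAct (ws : List (Wire q b)) :
    ∀ φ ψ : Basis q b → ℂ,
      ∑ x, φ x * hadamardsAct ws ψ x = ∑ x, hadamardsAct ws φ x * ψ x := by
  induction ws with
  | nil => intro φ ψ; rfl
  | cons w ws ih =>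
    intro φ ψ
    rw [hadamardsAct_cons, ih, sum_mul_hadamardAct, hadamardAct_hadamardsAct, hadamardsAct_cons]

theorem hadamardsAct_support (ws : List (Wire q b)) (v : Wire q b) (hv : v ∉ ws) :
    ∀ ψ : Basis q b → ℂ, (∀ x, ψ x ≠ 0 → x v = false) →
      ∀ x, hadamardsAct ws ψ x ≠ 0 → x v = false := by
  induction ws with
  | nil => intro ψ h; exact h
  | cons w ws ih =>
    intro ψ h
    rw [hadamardsAct_cons]
    refine ih (fun h => hv (by simp [h])) _ fun x hx => ?_
    by_contra hc
    have h1 : ψ x = 0 := by by_contra h0; exact hc (h x h0)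
    have h2 : ψ (flipBit w x) = 0 := by
      by_contra h0
      have := h _ h0
      rw [flipBit_of_ne (fun e => hv (by simp [e]))] at this
      exact hc this
    exact hx (by simp [hadamardAct, h1, h2])

/-- The all-zero basis state. -/
def zeroState (q b : ℕ) : Basis q b → ℂ := fun x => if x = fun _ => false then 1 else 0

-- Each further wire doubles the support: a basis state with that bit 0 takes its amplitude from
-- itself, one with that bit 1 from its flipped partner.
open Classical in
theorem hadamardsAct_zeroState (ws : List (Wire q b)) (hnd : ws.Nodup) :
    hadamardsAct ws (zeroState q b) =
      fun x => if ∀ v, v ∉ ws → x v = false then 1 / (Real.sqrt 2 : ℂ) ^ ws.length else 0 := by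
  induction ws using List.reverseRecOn with
  | nil => funext x; simp [hadamardsAct, zeroState, funext_iff]
  | append_singleton ws w ih =>
    have hnd' := List.nodup_append.1 hnd
    have hw : w ∉ ws := fun h => hnd'.2.2 w h w (by simp) rfl
    rw [hadamardsAct_append, ih hnd'.1]
    funext x
    have hc : hadamardsAct [w] = hadamardAct (q := q) (b := b) w := rfl
    rw [hc]
    simp only [hadamardAct, bitSign]
    have h1 : (∀ v, v ∉ ws → x v = false) ↔
        x w = false ∧ ∀ v, v ∉ ws ++ [w] → x v = false := by
      constructor
      · intro h
        exact ⟨h w hw, fun v hv => h v fun h' => hv (by simp [h'])⟩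
      · rintro ⟨h, h'⟩ v hv
        by_cases e : v = w
        · rw [e, h]
        · exact h' v (by simp [hv, e])
    have h2 : (∀ v, v ∉ ws → flipBit w x v = false) ↔
        x w = true ∧ ∀ v, v ∉ ws ++ [w] → x v = false := by
      constructor
      · intro h
        refine ⟨by simpa [flipBit] using h w hw, fun v hv => ?_⟩
        have := h v fun h' => hv (by simp [h'])
        rwa [flipBit_of_ne (fun e => hv (by simp [e]))] at this
      · rintro ⟨h, h'⟩ v hv
        by_cases e : v = w
        · rw [e]; simp [flipBit, h]
        · rw [flipBit_of_ne e]; exact h' v (by simp [hv, e])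
    simp only [h1, h2, List.length_append, List.length_singleton, pow_succ]
    by_cases h3 : ∀ v, v ∉ ws ++ [w] → x v = false
    · cases hx : x w <;> simp only [eq_true h3, if_true, and_self, and_true, Bool.false_eq_true,
        if_false, reduceCtorEq] <;> ring
    · simp only [eq_false h3, and_false, if_false, mul_zero, add_zero, zero_div]

/-! ### One Grover iteration -/

/-- All qubits outside the address register are `0`. -/
def Idle (x : Basis q b) : Prop := ∀ v, x (Sum.inr v) = false

instance : DecidablePred (Idle (q := q) (b := b)) := fun x => by unfold Idle; infer_instance

/-- The address register of a basis state. -/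
def address (x : Basis q b) : Fin q → Bool := fun k => x (addrW q b k)

/-- The address qubits. -/
def addrWires (q b : ℕ) : List (Wire q b) := (List.finRange q).map (addrW q b)

theorem addrWires_nodup : (addrWires q b).Nodup :=
  (List.nodup_finRange q).map Sum.inl_injective

theorem length_addrWires : (addrWires q b).length = q := by simp [addrWires]

theorem mem_addrWires (v : Wire q b) : v ∈ addrWires q b ↔ ∃ i, v = Sum.inl i := by
  simp [addrWires, eq_comm]

theorem idle_iff (x : Basis q b) : Idle x ↔ ∀ v, v ∉ addrWires q b → x v = false := by
  constructor
  · rintro h (i | i) hv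
    · exact absurd ((mem_addrWires _).2 ⟨i, rfl⟩) hv
    · exact h i
  · intro h v
    exact h _ (by simp [mem_addrWires])

theorem act_hadamards (mem : Memory q b) (ψ : Basis q b → ℂ) :
    Circuit.act mem (hadamards q b) ψ = hadamardsAct (addrWires q b) ψ := by
  simp only [Circuit.act, hadamards, hadamardsAct, addrWires, List.foldl_map, act_H]

theorem sqrt_two_pow_mul_self (k : ℕ) :
    (Real.sqrt 2 : ℂ) ^ k * (Real.sqrt 2 : ℂ) ^ k = 2 ^ k := by
  rw [← mul_pow, ofReal_sqrt_two_mul_self]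

/-- On idle vectors the phase flip is 1 - 2|0⟩⟨0|. Conjugation by the symmetric involution `T`
replaces |0⟩ by the uniform vector. The result is the negative of the usual reflection, which causes
the signs (-1)^k below. -/
theorem act_diffusion (mem : Memory q b) (ψ : Basis q b → ℂ) (hψ : ∀ x, ψ x ≠ 0 → Idle x) :
    Circuit.act mem (diffusion q b) ψ =
      fun x => ψ x - if Idle x then 2 / 2 ^ q * ∑ y, ψ y else 0 := by
  set T := hadamardsAct (addrWires q b) with hT
  have hclean : ∀ x, T ψ x ≠ 0 → Idle x := fun x hx v =>
    hadamardsAct_support (addrWires q b) (Sum.inr v) (by simp [mem_addrWires]) ψ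
      (fun y hy => hψ y hy v) x hx
  have hzero : T (zeroState q b) =
      fun x => if Idle x then 1 / (Real.sqrt 2 : ℂ) ^ q else 0 := by
    rw [hT, hadamardsAct_zeroState _ addrWires_nodup]
    funext x
    simp only [length_addrWires]
    by_cases hx : Idle x
    · rw [if_pos ((idle_iff x).1 hx), if_pos hx]
    · rw [if_neg (fun h => hx ((idle_iff x).2 h)), if_neg hx]
  have hflip : Circuit.act mem
      (phaseFlip ((List.finRange q).map fun i => (addrW q b i, false))) (T ψ) =
      fun x => T ψ x - 2 * T ψ (fun _ => false) * zeroState q b x := by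
    rw [act_phaseFlip]
    · funext x
      simp only [List.mem_map, List.mem_finRange, true_and, forall_exists_index,
        forall_apply_eq_imp_iff]
      by_cases h0 : T ψ x = 0
      · simp only [h0, neg_zero, ite_self, zeroState]
        split_ifs with h
        · rw [← h, h0]; simp
        · simp
      · have hx := hclean x h0
        have : (∀ i, x (addrW q b i) = false) ↔ x = fun _ => false := by
          constructor
          · intro h
            funext v
            rcases v with i | v
            · exact h i
            · exact hx v
          · intro h i; rw [h]
        simp only [this, zeroState]
        split_ifs with h
        · rw [← h]; ring
        · ring
    · rw [List.map_map]
      exact addrWires_nodup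
    · simp only [List.length_map, List.length_finRange]; omega
    · intro p hp i
      obtain ⟨j, _, rfl⟩ := List.mem_map.1 hp
      simp
    · intro x hx i
      exact hclean x hx _
  have hamp : T ψ (fun _ => false) = (1 / (Real.sqrt 2 : ℂ) ^ q) * ∑ y, ψ y := by
    have h1 := sum_mul_hadamardsAct (addrWires q b) (zeroState q b) ψ
    rw [← hT, hzero] at h1
    have h2 : ∑ x, zeroState q b x * T ψ x = T ψ (fun _ => false) := by
      rw [Finset.sum_eq_single (fun _ => false)]
      · simp [zeroState]
      · intro x _ hx; simp [zeroState, hx]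
      · simp
    rw [← h2, h1, Finset.mul_sum]
    refine Finset.sum_congr rfl fun x _ => ?_
    by_cases h0 : ψ x = 0
    · simp [h0]
    · simp [hψ x h0]
  unfold diffusion
  rw [Circuit.act_append, Circuit.act_append, act_hadamards, act_hadamards, ← hT, hflip, hT,
    hadamardsAct_sub_smul, ← hT, hzero, hamp]
  have : T (T ψ) = ψ := hadamardsAct_hadamardsAct _ ψ
  rw [this]
  funext x
  dsimp only
  have hs := sqrt_two_pow_mul_self q
  have h0 : (Real.sqrt 2 : ℂ) ^ q ≠ 0 := pow_ne_zero _ ofReal_sqrt_two_ne_zero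
  by_cases hx : Idle x
  · rw [if_pos hx, if_pos hx, ← hs]; field_simp
  · simp [hx]

/-- Different words are mutually exclusive patterns, so no basis state is negated twice. -/
theorem act_flatMap_phaseFlip (mem : Memory q b) (vs : List (Fin (b + 1) → Bool)) :
    ∀ (ψ : Basis q b → ℂ), vs.Nodup → (∀ x, ψ x ≠ 0 → ∀ i, x (ancW q b i) = false) →
      Circuit.act mem (vs.flatMap fun v =>
        phaseFlip ((List.finRange (b + 1)).map fun i => (cellW q b i, v i))) ψ =
        fun x => if (fun i => x (cellW q b i)) ∈ vs then -ψ x else ψ x := by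
  induction vs with
  | nil => intro ψ _ _; funext x; simp [Circuit.act]
  | cons v vs ih =>
    intro ψ hnd hψ
    rw [List.nodup_cons] at hnd
    rw [List.flatMap_cons, Circuit.act_append, act_phaseFlip]
    · have hpat : ∀ x : Basis q b,
          (∀ p ∈ (List.finRange (b + 1)).map fun i => (cellW q b i, v i), x p.1 = p.2) ↔
          (fun i => x (cellW q b i)) = v := by
        intro x
        simp [funext_iff]
      simp only [hpat]
      rw [ih _ hnd.2]
      · funext x
        by_cases h1 : (fun i => x (cellW q b i)) = v
        · simp [h1, hnd.1]
        · simp [h1]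
      · intro x hx
        refine hψ x fun h0 => hx ?_
        simp [h0]
    · rw [List.map_map]
      exact (List.nodup_finRange _).map fun i j h => by simpa using h
    · simp only [List.length_map, List.length_finRange]; omega
    · intro p hp i
      obtain ⟨j, _, rfl⟩ := List.mem_map.1 hp
      simp
    · exact hψ

/-- The cell register starts at 0, so loading writes exactly `mem (address x)` into it. Negating
marked words then negates marked addresses, and the second load clears the register. -/
theorem act_oracle (mem : Memory q b) (marked : Finset (Fin (b + 1) → Bool))
    (ψ : Basis q b → ℂ) (hψ : ∀ x, ψ x ≠ 0 → Idle x) :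
    Circuit.act mem (oracle q marked) ψ =
      fun x => if mem (address x) ∈ marked then -ψ x else ψ x := by
  unfold oracle
  rw [Circuit.act_append, Circuit.act_append, Circuit.act_singleton, Circuit.act_singleton,
    act_flatMap_phaseFlip _ _ _ marked.nodup_toList]
  · funext x
    simp only [Gate.act, load_involutive mem x, Finset.mem_toList]
    by_cases h0 : ψ x = 0
    · simp [h0]
    · have hx := hψ x h0
      have : (fun i => load mem x (cellW q b i)) = mem (address x) := by
        funext i
        simp only [load]
        rw [hx]
        exact Bool.false_xor _
      rw [this]
  · intro x hx i
    exact hψ _ hx (Sum.inr i)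

theorem sum_idle (f : (Fin q → Bool) → ℂ) :
    ∑ x : Basis q b, (if Idle x then f (address x) else 0) = ∑ a, f a := by
  classical
  rw [← Finset.sum_filter]
  refine Finset.sum_bij' (fun x _ => address x) (fun a _ => Sum.elim a fun _ => false)
    ?_ ?_ ?_ ?_ ?_
  · intro x _; simp
  · intro a _; simp [Idle]
  · intro x hx
    have hx : Idle x := by simpa using hx
    funext v
    rcases v with i | v
    · rfl
    · simp [hx v]
  · intro a _; rfl
  · intro x _; rfl

end QTrack

namespace QTrack

variable {q b : ℕ}

/-! ### Grover search -/

/-- The addresses of marked memory cells. -/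
def markedAddresses (mem : Memory q b) (marked : Finset (Fin (b + 1) → Bool)) :
    Finset (Fin q → Bool) := {a | mem a ∈ marked}

theorem mem_markedAddresses (mem : Memory q b) (marked : Finset (Fin (b + 1) → Bool))
    (a : Fin q → Bool) : a ∈ markedAddresses mem marked ↔ mem a ∈ marked := by
  simp [markedAddresses]

theorem sum_ite_markedAddresses (mem : Memory q b) (marked : Finset (Fin (b + 1) → Bool))
    (u v : ℂ) :
    ∑ a, (if mem a ∈ marked then u else v) =
      (markedAddresses mem marked).card * u +
        (2 ^ q - (markedAddresses mem marked).card) * v := by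
  rw [Finset.sum_ite, Finset.sum_const, Finset.sum_const, nsmul_eq_mul, nsmul_eq_mul]
  have h := Finset.card_filter_add_card_filter_not (s := (Finset.univ : Finset (Fin q → Bool)))
    (fun a => mem a ∈ marked)
  have hc : ((markedAddresses mem marked).card : ℂ) +
      ((Finset.univ.filter fun a => ¬ mem a ∈ marked).card : ℂ) = 2 ^ q := by
    rw [markedAddresses, ← Nat.cast_add, h]
    simp
  have hc' : ((Finset.univ.filter fun a => ¬ mem a ∈ marked).card : ℂ) =
      2 ^ q - (markedAddresses mem marked).card := by rw [← hc]; ring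
  rw [hc']
  rfl

/-- Idle vectors that are constant on the marked and on the unmarked addresses are preserved, which
reduces an iteration to a linear map in two amplitudes. -/
theorem act_iteration (mem : Memory q b) (marked : Finset (Fin (b + 1) → Bool)) (u v : ℂ) :
    Circuit.act mem (oracle q marked ++ diffusion q b)
      (fun x => if Idle x then (if mem (address x) ∈ marked then u else v) else 0) =
    fun x => if Idle x then
      ((if mem (address x) ∈ marked then -u else v) -
        2 / 2 ^ q * ((markedAddresses mem marked).card * -u +
          (2 ^ q - (markedAddresses mem marked).card) * v)) else 0 := by
  have hs : ∀ x : Basis q b, (if Idle x then (if mem (address x) ∈ marked then u else v) else 0) ≠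
      0 → Idle x := fun x hx => by
    by_contra h
    exact hx (if_neg h)
  have he : (fun x : Basis q b => if mem (address x) ∈ marked then
      -(if Idle x then (if mem (address x) ∈ marked then u else v) else 0)
      else if Idle x then (if mem (address x) ∈ marked then u else v) else 0) =
      fun x => if Idle x then (if mem (address x) ∈ marked then -u else v) else 0 := by
    funext x
    split_ifs <;> simp
  rw [Circuit.act_append, act_oracle mem marked _ hs, he, act_diffusion]
  · funext x
    rw [sum_idle (fun a => if mem a ∈ marked then -u else v), sum_ite_markedAddresses]
    by_cases hx : Idle x
    · simp only [if_pos hx]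
    · simp only [if_neg hx, sub_zero]
  · intro x hx
    by_contra h
    exact hx (if_neg h)

/-- Up to sign, an iteration rotates the plane of marked and unmarked uniform vectors by 2θ. The
unmarked amplitude stays existential: it is not needed, and it is undetermined when all addresses
are marked. -/
theorem final_grover (mem : Memory q b) (marked : Finset (Fin (b + 1) → Bool))
    (ht : 0 < (markedAddresses mem marked).card) (θ : ℝ)
    (hsin : √(2 ^ q) * Real.sin θ = √((markedAddresses mem marked).card))
    (hcos : √(2 ^ q) * Real.cos θ = √(2 ^ q - (markedAddresses mem marked).card)) (k : ℕ) :
    ∃ v : ℂ, Circuit.final mem (grover q marked k) = fun x : Basis q b =>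
      if Idle x then (if mem (address x) ∈ marked then
        (((-1) ^ k * Real.sin ((2 * k + 1) * θ) / √((markedAddresses mem marked).card) : ℝ) : ℂ)
        else v) else 0 := by
  set t := (markedAddresses mem marked).card with htdef
  have htle : (t : ℝ) ≤ 2 ^ q := by
    have := Finset.card_le_univ (markedAddresses mem marked)
    rw [← htdef, Fintype.card_fun, Fintype.card_bool, Fintype.card_fin] at this
    exact_mod_cast this
  have ht' : (0 : ℝ) < t := by exact_mod_cast ht
  have hN : (0 : ℝ) < 2 ^ q := by positivity
  have hsN : 0 < √((2 : ℝ) ^ q) := Real.sqrt_pos.2 hN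
  have hst : 0 < √(t : ℝ) := Real.sqrt_pos.2 ht'
  have hsN2 : √((2 : ℝ) ^ q) * √((2 : ℝ) ^ q) = 2 ^ q := Real.mul_self_sqrt hN.le
  have hst2 : √(t : ℝ) * √(t : ℝ) = t := Real.mul_self_sqrt ht'.le
  have hsc2 : √((2 : ℝ) ^ q - t) * √((2 : ℝ) ^ q - t) = 2 ^ q - t :=
    Real.mul_self_sqrt (by linarith)
  set α : ℕ → ℝ := fun k => (-1) ^ k * Real.sin ((2 * k + 1) * θ) / √(t : ℝ) with hα
  set β : ℕ → ℝ := fun k => (-1) ^ k * Real.cos ((2 * k + 1) * θ) / √((2 : ℝ) ^ q - t) with hβ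
  -- The factor `2 ^ q - t` keeps the relation between `v` and `β k` valid when all addresses are
  -- marked and the denominator of `β` is 0.
  have step : ∀ (k : ℕ) (v : ℝ), ((2 : ℝ) ^ q - t) * v = (2 ^ q - t) * β k →
      -(α k) - 2 / 2 ^ q * (t * -(α k) + (2 ^ q - t) * v) = α (k + 1) ∧
      ((2 : ℝ) ^ q - t) * (v - 2 / 2 ^ q * (t * -(α k) + (2 ^ q - t) * v)) =
        (2 ^ q - t) * β (k + 1) := by
    intro k v hv
    set ω := (2 * (k : ℝ) + 1) * θ with hω
    have hω' : (2 * ((k + 1 : ℕ) : ℝ) + 1) * θ = (ω + θ) + θ := by rw [hω]; push_cast; ring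
    -- The old angle ω and the new angle ω + 2θ are both expanded about their midpoint, because the
    -- sum of all amplitudes after the oracle is a multiple of cos(ω + θ).
    have hω2 : ω = (ω + θ) - θ := by ring
    have e1 : (t : ℝ) * α k = (-1) ^ k * Real.sin ω * √(t : ℝ) := by
      simp only [hα, ← hω]
      rw [mul_div_left_comm, Real.div_sqrt]
    have e2 : ((2 : ℝ) ^ q - t) * v = (-1) ^ k * Real.cos ω * √((2 : ℝ) ^ q - t) := by
      rw [hv]
      simp only [hβ, ← hω]
      rw [mul_div_left_comm, Real.div_sqrt]
    have e3 : (t : ℝ) * -(α k) + (2 ^ q - t) * v =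
        (-1) ^ k * √((2 : ℝ) ^ q) * Real.cos (ω + θ) := by
      rw [mul_neg, e1, e2, ← hsin, ← hcos, Real.cos_add]; ring
    rw [e3]
    have e4 : 2 / 2 ^ q * ((-1) ^ k * √((2 : ℝ) ^ q) * Real.cos (ω + θ)) =
        2 * (-1) ^ k * Real.cos (ω + θ) / √((2 : ℝ) ^ q) := by
      nth_rewrite 1 [← hsN2]
      field_simp
    rw [e4]
    constructor
    · simp only [hα]
      rw [hω', Real.sin_add (ω + θ) θ, pow_succ, ← hω]
      have : Real.sin ω = Real.sin (ω + θ) * Real.cos θ - Real.cos (ω + θ) * Real.sin θ := by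
        conv_lhs => rw [hω2]
        rw [Real.sin_sub]
      rw [this, ← hsin]
      have hs0 : Real.sin θ ≠ 0 := fun h0 => by rw [h0, mul_zero] at hsin; exact hst.ne hsin
      field_simp
      ring
    · have e5 : ((2 : ℝ) ^ q - t) * β (k + 1) =
          (-1) ^ (k + 1) * Real.cos (ω + θ + θ) * √((2 : ℝ) ^ q - t) := by
        simp only [hβ, hω']
        rw [mul_div_left_comm, Real.div_sqrt]
      have e6 : ((2 : ℝ) ^ q - t) * (2 * (-1) ^ k * Real.cos (ω + θ) / √((2 : ℝ) ^ q)) =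
          √((2 : ℝ) ^ q - t) * Real.cos θ * (2 * (-1) ^ k * Real.cos (ω + θ)) := by
        rw [← hsc2]
        nth_rewrite 2 [← hcos]
        rw [Real.sqrt_mul_self (Real.sqrt_nonneg _)]
        field_simp
      rw [mul_sub, e2, e5, e6, Real.cos_add (ω + θ) θ, pow_succ]
      have : Real.cos ω = Real.cos (ω + θ) * Real.cos θ + Real.sin (ω + θ) * Real.sin θ := by
        conv_lhs => rw [hω2]
        rw [Real.cos_sub]
      rw [this]
      ring
  suffices h : ∃ v : ℝ, ((2 : ℝ) ^ q - t) * v = (2 ^ q - t) * β k ∧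
      Circuit.final mem (grover q marked k) = fun x : Basis q b =>
        if Idle x then (if mem (address x) ∈ marked then ((α k : ℝ) : ℂ) else (v : ℂ)) else 0 by
    obtain ⟨v, -, hv⟩ := h
    exact ⟨v, hv⟩
  induction k with
  | zero =>
    refine ⟨1 / √((2 : ℝ) ^ q), ?_, ?_⟩
    · simp only [hβ]
      rcases eq_or_ne ((2 : ℝ) ^ q - t) 0 with h0 | h0
      · rw [h0]; ring
      · have h1 : √((2 : ℝ) ^ q - t) ≠ 0 := fun h => h0 (by rw [← hsc2, h]; ring)
        rw [← hcos] at h1 ⊢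
        have := right_ne_zero_of_mul h1
        simp only [Nat.cast_zero, mul_zero, zero_add, one_mul, pow_zero]
        field_simp
    · have : Circuit.final mem (grover q marked 0) =
          Circuit.act mem (hadamards q b) (zeroState q b) := by
        simp only [grover, List.replicate_zero, List.flatten_nil, List.append_nil]
        rfl
      rw [this, act_hadamards, hadamardsAct_zeroState _ addrWires_nodup]
      funext x
      have hα0 : α 0 = 1 / √((2 : ℝ) ^ q) := by
        simp only [hα]
        have hs0 : Real.sin θ ≠ 0 := fun h0 => by rw [h0, mul_zero] at hsin; exact hst.ne hsin
        rw [← hsin]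
        simp only [Nat.cast_zero, mul_zero, zero_add, one_mul, pow_zero]
        field_simp
      rw [hα0, ite_self, length_addrWires]
      have hp : √((2 : ℝ) ^ q) = √2 ^ q := by
        rw [Real.sqrt_eq_iff_mul_self_eq (by positivity) (by positivity), ← mul_pow,
          Real.mul_self_sqrt (by norm_num)]
      rw [hp]
      push_cast
      by_cases hx : Idle x
      · rw [if_pos ((idle_iff x).1 hx), if_pos hx]
      · rw [if_neg (fun h => hx ((idle_iff x).2 h)), if_neg hx]
  | succ k ih =>
    obtain ⟨v, hv, ih⟩ := ih
    obtain ⟨h1, h2⟩ := step k v hv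
    refine ⟨_, h2, ?_⟩
    have : Circuit.final mem (grover q marked (k + 1)) =
        Circuit.act mem (oracle q marked ++ diffusion q b)
          (Circuit.final mem (grover q marked k)) := by
      simp only [grover, List.replicate_succ', List.flatten_append, List.flatten_singleton,
        ← List.append_assoc (hadamards q b)]
      exact Circuit.act_append mem _ _ _
    rw [this, ih, act_iteration]
    funext x
    by_cases hx : Idle x
    · by_cases hm : mem (address x) ∈ marked
      · simp only [if_pos hx, if_pos hm]
        rw [← h1]; push_cast; rfl
      · simp only [if_pos hx, if_neg hm]
        push_cast; rfl
    · simp only [if_neg hx]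

/-- Only one idle basis state has a given address, so a single amplitude contributes. The value does
not depend on the marked address: the outcome, given success, is uniform. -/
theorem measure_grover (mem : Memory q b) (marked : Finset (Fin (b + 1) → Bool))
    (ht : 0 < (markedAddresses mem marked).card) (θ : ℝ)
    (hsin : √(2 ^ q) * Real.sin θ = √((markedAddresses mem marked).card))
    (hcos : √(2 ^ q) * Real.cos θ = √(2 ^ q - (markedAddresses mem marked).card)) (k : ℕ)
    (a : Fin q → Bool) (ha : a ∈ markedAddresses mem marked) :
    Circuit.measure mem (grover q marked k) a =
      ENNReal.ofReal (Real.sin ((2 * k + 1) * θ) ^ 2 / (markedAddresses mem marked).card) := by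
  classical
  obtain ⟨v, hv⟩ := final_grover mem marked ht θ hsin hcos k
  unfold Circuit.measure
  rw [PMF.map_apply, tsum_fintype]
  rw [Finset.sum_eq_single (Sum.elim a fun _ => false)]
  · have h1 : Idle (Sum.elim a fun _ => false : Basis q b) := fun _ => rfl
    have h2 : address (Sum.elim a fun _ => false : Basis q b) = a := rfl
    refine (if_pos rfl).trans ?_
    rw [PMF.ofFintype_apply, hv]
    dsimp only
    rw [if_pos h1, h2, if_pos ((mem_markedAddresses _ _ _).1 ha), Complex.norm_real,
      Real.norm_eq_abs, sq_abs, div_pow, Real.sq_sqrt (by positivity), mul_pow, ← pow_mul,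
      mul_comm k 2, pow_mul]
    simp
  · intro x _ hx
    split_ifs with h
    · rw [PMF.ofFintype_apply, hv]
      have : ¬ Idle x := by
        intro hi
        apply hx
        funext w
        rcases w with i | w
        · exact (congrFun h i).symm
        · exact hi w
      simp [this]
    · rfl
  · simp

end QTrack

namespace QTrack

/-! ### Expected cost of the exponential search -/

/-- The number of choices for the number of Grover iterations after `s` failures. -/
noncomputable def iterationChoices (q s : ℕ) : ℕ :=
  ⌈min ((6 / 5 : ℝ) ^ s) (Real.sqrt (2 ^ q))⌉₊

theorem one_le_sqrt_two_pow (q : ℕ) : (1 : ℝ) ≤ √(2 ^ q) :=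
  Real.one_le_sqrt.2 (one_le_pow₀ (by norm_num))

theorem one_le_min_pow_sqrt (q s : ℕ) : (1 : ℝ) ≤ min ((6 / 5 : ℝ) ^ s) (√(2 ^ q)) :=
  le_min (one_le_pow₀ (by norm_num)) (one_le_sqrt_two_pow q)

theorem iterationChoices_pos (q s : ℕ) : 0 < iterationChoices q s :=
  Nat.ceil_pos.2 (lt_of_lt_of_le one_pos (one_le_min_pow_sqrt q s))

theorem iterationChoices_zero (q : ℕ) : iterationChoices q 0 = 1 := by
  simp [iterationChoices, min_eq_left (one_le_sqrt_two_pow q)]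

theorem sum_range_add_one (M : ℕ) : ∑ k ∈ Finset.range M, ((k : ℝ) + 1) = M * (M + 1) / 2 := by
  induction M with
  | zero => simp
  | succ M ih => rw [Finset.sum_range_succ, ih]; push_cast; ring

/-- The sum telescopes after multiplication by sin 2θ. Dividing back gives the average failure
probability 1/2 + sin(4Mθ)/(4M sin 2θ) of an attempt. -/
theorem sum_range_cos_sq (θ : ℝ) (M : ℕ) :
    Real.sin (2 * θ) * ∑ k ∈ Finset.range M, Real.cos ((2 * k + 1) * θ) ^ 2 =
      Real.sin (2 * θ) * (M / 2) + Real.sin (4 * M * θ) / 4 := by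
  induction M with
  | zero => simp
  | succ M ih =>
    rw [Finset.sum_range_succ, mul_add, ih]
    set ω := (2 * (M : ℝ) + 1) * θ with hω
    have e1 : 4 * ((M + 1 : ℕ) : ℝ) * θ = 2 * ω + 2 * θ := by rw [hω]; push_cast; ring
    have e2 : 4 * (M : ℝ) * θ = 2 * ω - 2 * θ := by rw [hω]; ring
    rw [e1, e2, Real.sin_add, Real.sin_sub, Real.cos_two_mul ω]
    push_cast
    ring

/-- A bound on the expected number of further oracle calls of an exponential search, in terms of
the bound `m` on the number of iterations of its next attempt and the inverse `m₀` of the sine of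
twice the Grover angle. -/
noncomputable def searchCost (m₀ m : ℝ) : ℝ :=
  if m < 3 / 4 * m₀ then 81 / 8 * m₀ + 6 - 15 / 2 * m else 5 / 4 * m + 9 / 4 * m₀ + 6

theorem searchCost_nonneg {m₀ m : ℝ} (h₀ : 0 ≤ m₀) (hm : 0 ≤ m) : 0 ≤ searchCost m₀ m := by
  unfold searchCost
  split_ifs <;> linarith

/-- Here failure is bounded by 1 only, and the slope -15/2 pays for the attempt: growth by m/5
releases 3m/2 ≥ m/2 + 1. The constant 81/8 also pays for crossing into the late range, where 19m/2 +
1 ≤ 21m/2 ≤ 63m₀/8 is needed. -/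
theorem searchCost_step_early {m₀ m : ℝ} (hm : 1 ≤ m) (h : m < 3 / 4 * m₀) :
    m / 2 + 1 + searchCost m₀ (6 / 5 * m) ≤ searchCost m₀ m := by
  unfold searchCost
  rw [if_pos h]
  split_ifs <;> linarith

/-- The slope a = 5/4 solves 1/2 + (1/2)(6/5)a = a. The excess failure probability m₀/(4m),
multiplied by the linear term, adds at most 3m₀/8. Since the failure probability is at most 5/6, a
sixth of the constant 9m₀/4 + 6 is released, which is 3m₀/8 + 1. -/
theorem searchCost_step_late {m₀ m m' : ℝ} (h₀ : 0 ≤ m₀) (hm : 1 ≤ m) (hmm : m ≤ m')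
    (hm' : m' ≤ 6 / 5 * m) (h : 3 / 4 * m₀ ≤ m) :
    m / 2 + 1 + (1 / 2 + m₀ / (4 * m)) * searchCost m₀ m' ≤ searchCost m₀ m := by
  unfold searchCost
  rw [if_neg (not_lt.2 h), if_neg (not_lt.2 (h.trans hmm))]
  have hm0 : 0 < m := by linarith
  have h1 : m₀ / (4 * m) ≤ 1 / 3 := by
    rw [div_le_iff₀ (by linarith)]; linarith
  have h2 : 0 ≤ m₀ / (4 * m) := by positivity
  have h3 : m₀ / (4 * m) * m = m₀ / 4 := by field_simp
  have h4 : (1 / 2 + m₀ / (4 * m)) * (5 / 4 * m' + 9 / 4 * m₀ + 6) ≤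
      (1 / 2 + m₀ / (4 * m)) * (5 / 4 * (6 / 5 * m) + 9 / 4 * m₀ + 6) :=
    mul_le_mul_of_nonneg_left (by linarith) (by linarith)
  have h5 : m₀ / (4 * m) * (9 / 4 * m₀ + 6) ≤ 1 / 3 * (9 / 4 * m₀ + 6) :=
    mul_le_mul_of_nonneg_right h1 (by linarith)
  nlinarith

/-- Here v and w stand for the sine and cosine of the Grover angle. The first attempt makes no
iteration, so it costs one call and fails with probability w². This factor compensates m₀ = 1/(2vw),
which is unbounded as w tends to 0. After multiplication by v the two ranges are bounded by v² +
81w/16 and by v + 3 + 9w/8. -/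
theorem searchCost_start {v w : ℝ} (hv : 0 < v) (hw : 0 < w) (h : v ^ 2 + w ^ 2 = 1) :
    1 + w ^ 2 * searchCost (1 / (2 * v * w)) (6 / 5) ≤ 45 / 8 / v := by
  have hv1 : v ≤ 1 := by nlinarith
  have hw1 : w ≤ 1 := by nlinarith
  have hw2 : w ^ 2 = 1 - v ^ 2 := by linarith
  have hvw : v * (w ^ 2 * (1 / (2 * v * w))) = w / 2 := by field_simp
  rw [le_div_iff₀ hv]
  unfold searchCost
  split_ifs
  · have e : (1 + w ^ 2 * (81 / 8 * (1 / (2 * v * w)) + 6 - 15 / 2 * (6 / 5))) * v =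
        v - 3 * w ^ 2 * v + 81 / 8 * (v * (w ^ 2 * (1 / (2 * v * w)))) := by ring
    rw [e, hvw]
    have h1 : v - 3 * w ^ 2 * v ≤ v ^ 2 := by
      rw [hw2]
      have : 0 ≤ v * (3 * v + 2) * (1 - v) :=
        mul_nonneg (by positivity) (by linarith)
      nlinarith
    nlinarith
  · have e : (1 + w ^ 2 * (5 / 4 * (6 / 5) + 9 / 4 * (1 / (2 * v * w)) + 6)) * v =
        v + 15 / 2 * (w ^ 2 * v) + 9 / 4 * (v * (w ^ 2 * (1 / (2 * v * w)))) := by ring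
    rw [e, hvw]
    have h1 : w ^ 2 * v ≤ 2 / 5 := by
      rw [hw2]
      -- The maximum of v - v³ is at 1/√3 ≈ 0.577. The hint approximates the factorisation v³ - v +
      -- 2/(3√3) = (v + 2/√3)(v - 1/√3)².
      nlinarith [mul_nonneg (by linarith : (0 : ℝ) ≤ v + 1.155)
        (sq_nonneg (v - 0.577))]
    nlinarith

/-- Bounds `τ s` on the expected number of further oracle calls of an exponential search after `s`
failures, when `t` of `2 ^ q` addresses are marked. -/
theorem exists_searchCost (q t : ℕ) (ht : 0 < t) (htN : t ≤ 2 ^ q) (θ : ℝ)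
    (hsin : √(2 ^ q) * Real.sin θ = √t) (hcos : √(2 ^ q) * Real.cos θ = √(2 ^ q - t)) :
    ∃ τ : ℕ → ℝ, (∀ s, 0 ≤ τ s) ∧ τ 0 ≤ 45 / 8 * √(2 ^ q) / √t ∧
      ∀ s, ∑ k ∈ Finset.range (iterationChoices q s),
        (((k : ℝ) + 1) + Real.cos ((2 * k + 1) * θ) ^ 2 * τ (s + 1)) ≤
          iterationChoices q s * τ s := by
  have hN : (0 : ℝ) < 2 ^ q := by positivity
  have ht' : (0 : ℝ) < t := by exact_mod_cast ht
  have hR : 0 < √((2 : ℝ) ^ q) := Real.sqrt_pos.2 hN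
  have hst : 0 < √(t : ℝ) := Real.sqrt_pos.2 ht'
  -- If all addresses are marked, sin 2θ = 0 and m₀ makes no sense; but then no attempt fails, and
  -- the mean number (M + 1)/2 of calls of one attempt is the whole cost.
  rcases eq_or_lt_of_le htN with htN | htN
  · have htN' : (t : ℝ) = 2 ^ q := by exact_mod_cast htN
    have hc : Real.cos θ = 0 := by
      rw [htN', sub_self, Real.sqrt_zero] at hcos
      exact (mul_eq_zero.1 hcos).resolve_left hR.ne'
    have hck : ∀ k : ℕ, Real.cos ((2 * k + 1) * θ) = 0 := by
      intro k
      obtain ⟨j, hj⟩ := Real.cos_eq_zero_iff.1 hc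
      refine Real.cos_eq_zero_iff.2 ⟨2 * k * j + k + j, ?_⟩
      rw [hj]; push_cast; ring
    refine ⟨fun s => (iterationChoices q s + 1) / 2, fun s => by positivity, ?_, fun s => ?_⟩
    · dsimp only
      rw [iterationChoices_zero, htN', mul_div_assoc, div_self hR.ne']
      norm_num
    · simp only [hck]
      have := sum_range_add_one (iterationChoices q s)
      simp only [ne_eq, OfNat.ofNat_ne_zero, not_false_eq_true, zero_pow, zero_mul, add_zero]
      rw [this, mul_div_assoc]
  · have htN' : (t : ℝ) + 1 ≤ 2 ^ q := by exact_mod_cast htN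
    have ht1 : (1 : ℝ) ≤ t := by exact_mod_cast ht
    have hsc : 0 < √((2 : ℝ) ^ q - t) := Real.sqrt_pos.2 (by linarith)
    set R := √((2 : ℝ) ^ q) with hRdef
    set v := Real.sin θ with hv
    set w := Real.cos θ with hw
    have hv0 : 0 < v := pos_of_mul_pos_right (hsin ▸ hst) hR.le
    have hw0 : 0 < w := pos_of_mul_pos_right (hcos ▸ hsc) hR.le
    have hvw : v ^ 2 + w ^ 2 = 1 := Real.sin_sq_add_cos_sq θ
    have hsin2 : Real.sin (2 * θ) = 2 * v * w := Real.sin_two_mul θ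
    set m₀ := 1 / (2 * v * w) with hm₀
    have hm₀pos : 0 < m₀ := by positivity
    -- From (t - 1)(N - t - 1) ≥ 0 and N ≥ 2 follows 4t(N - t) ≥ N. Hence the cap √N is inactive
    -- throughout the early range: the next value is at most (9/10)m₀.
    have hm₀R : m₀ ≤ R := by
      have hR2 : R ^ 2 = 2 ^ q := Real.sq_sqrt hN.le
      have e1 : (R * v) ^ 2 = t := by rw [hsin, Real.sq_sqrt ht'.le]
      have e2 : (R * w) ^ 2 = 2 ^ q - t := by rw [hcos, Real.sq_sqrt (by linarith)]
      have h3 : R ^ 2 ≤ (2 * (R * v) * (R * w)) ^ 2 := by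
        have : (2 * (R * v) * (R * w)) ^ 2 = 4 * ((R * v) ^ 2 * (R * w) ^ 2) := by ring
        rw [this, e1, e2, hR2]
        nlinarith [mul_nonneg (sub_nonneg.2 ht1)
          (show (0 : ℝ) ≤ 2 ^ q - t - 1 by linarith)]
      have h4 : R ≤ 2 * (R * v) * (R * w) := by
        exact (pow_le_pow_iff_left₀ hR.le (by positivity) two_ne_zero).1 h3
      rw [hm₀, div_le_iff₀ (by positivity)]
      have : R * 1 ≤ R * (R * (2 * v * w)) := by linarith
      exact le_of_mul_le_mul_left this hR
    have hR65 : 6 / 5 ≤ R := by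
      rw [hRdef]
      apply Real.le_sqrt_of_sq_le
      linarith
    set m : ℕ → ℝ := fun s => min ((6 / 5 : ℝ) ^ s) R with hm
    have hm1 : ∀ s, 1 ≤ m s := fun s => one_le_min_pow_sqrt q s
    have hMm : ∀ s, m s ≤ iterationChoices q s := fun s => Nat.le_ceil _
    have hMm1 : ∀ s, (iterationChoices q s : ℝ) ≤ m s + 1 := fun s =>
      (Nat.ceil_lt_add_one (by linarith [hm1 s] : (0 : ℝ) ≤ m s)).le
    have hstep : ∀ s, m s / 2 + 1 +
        min 1 (1 / 2 + m₀ / (4 * m s)) * searchCost m₀ (m (s + 1)) ≤ searchCost m₀ (m s) := by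
      intro s
      have hsc0 := searchCost_nonneg hm₀pos.le (by linarith [hm1 (s + 1)] : 0 ≤ m (s + 1))
      have hle : m (s + 1) ≤ 6 / 5 * m s := by
        simp only [hm, pow_succ]
        rcases le_total ((6 / 5 : ℝ) ^ s) R with h | h
        · rw [min_eq_left h]; exact (min_le_left _ _).trans (by linarith)
        · rw [min_eq_right h]; exact (min_le_right _ _).trans (by linarith)
      rcases lt_or_ge (m s) (3 / 4 * m₀) with h | h
      · have h1 : m s = (6 / 5 : ℝ) ^ s := by
          simp only [hm]
          rcases le_total ((6 / 5 : ℝ) ^ s) R with h' | h'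
          · exact min_eq_left h'
          · simp only [hm, min_eq_right h'] at h; linarith
        have h2 : m (s + 1) = 6 / 5 * m s := by
          rw [h1]
          simp only [hm, pow_succ]
          rw [min_eq_left (by rw [← h1]; linarith)]; ring
        have h3 := searchCost_step_early (hm1 s) h
        rw [← h2] at h3
        have : min 1 (1 / 2 + m₀ / (4 * m s)) * searchCost m₀ (m (s + 1)) ≤
            1 * searchCost m₀ (m (s + 1)) := mul_le_mul_of_nonneg_right (min_le_left _ _) hsc0
        linarith
      · have hmono : m s ≤ m (s + 1) :=
          min_le_min_right _ (pow_le_pow_right₀ (by norm_num) (Nat.le_succ s))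
        have h3 := searchCost_step_late hm₀pos.le (hm1 s) hmono hle h
        have : min 1 (1 / 2 + m₀ / (4 * m s)) * searchCost m₀ (m (s + 1)) ≤
            (1 / 2 + m₀ / (4 * m s)) * searchCost m₀ (m (s + 1)) :=
          mul_le_mul_of_nonneg_right (min_le_right _ _) hsc0
        linarith
    have hm_one : m 1 = 6 / 5 := by simp only [hm, pow_one]; exact min_eq_left hR65
    have hcosSum : ∀ s, ∑ k ∈ Finset.range (iterationChoices q s),
        Real.cos ((2 * k + 1) * θ) ^ 2 ≤
          iterationChoices q s * min 1 (1 / 2 + m₀ / (4 * m s)) := by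
      intro s
      set M := iterationChoices q s with hM
      have hM0 : (0 : ℝ) < M := by exact_mod_cast iterationChoices_pos q s
      rw [mul_min_of_nonneg _ _ hM0.le]
      refine le_min ?_ ?_
      · calc ∑ k ∈ Finset.range M, Real.cos ((2 * k + 1) * θ) ^ 2
            ≤ ∑ k ∈ Finset.range M, (1 : ℝ) := Finset.sum_le_sum fun k _ => Real.cos_sq_le_one _
          _ = M * 1 := by simp
      · have h1 := sum_range_cos_sq θ M
        rw [hsin2] at h1
        have h2 : ∑ k ∈ Finset.range M, Real.cos ((2 * k + 1) * θ) ^ 2 =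
            M / 2 + m₀ * Real.sin (4 * M * θ) / 4 := by
          have h0 : 2 * v * w ≠ 0 := by positivity
          apply mul_left_cancel₀ h0
          rw [h1, hm₀]
          field_simp
        have h3 : m₀ * Real.sin (4 * M * θ) ≤ m₀ * 1 :=
          mul_le_mul_of_nonneg_left (Real.sin_le_one _) hm₀pos.le
        have h4 : m₀ / 4 ≤ M * (m₀ / (4 * m s)) := by
          have : m₀ / 4 = m s * (m₀ / (4 * m s)) := by
            have := hm1 s
            field_simp
          rw [this]
          have := hm1 s
          exact mul_le_mul_of_nonneg_right (hMm s) (by positivity)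
        rw [h2]; linarith
    -- At `s = 0` the exact cost of the first attempt is used, because the generic potential lacks
    -- the factor `w ^ 2` needed in `searchCost_start`.
    refine ⟨fun s => if s = 0 then 1 + w ^ 2 * searchCost m₀ (m 1) else searchCost m₀ (m s),
      fun s => ?_, ?_, fun s => ?_⟩
    · have h1 := searchCost_nonneg hm₀pos.le (by linarith [hm1 1] : 0 ≤ m 1)
      have h2 := searchCost_nonneg hm₀pos.le (by linarith [hm1 s] : 0 ≤ m s)
      dsimp only
      split_ifs
      · positivity
      · exact h2
    · dsimp only
      rw [if_pos rfl, hm_one]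
      have := searchCost_start hv0 hw0 hvw
      refine this.trans (le_of_eq ?_)
      rw [← hsin]
      field_simp
    · rcases s with _ | s
      · rw [iterationChoices_zero]
        simp [← hw]
      · simp only [Nat.add_eq_zero_iff, one_ne_zero, and_false, if_false]
        rw [Finset.sum_add_distrib, sum_range_add_one, ← Finset.sum_mul]
        set M := iterationChoices q (s + 1) with hM
        have hM0 : (0 : ℝ) < M := by exact_mod_cast iterationChoices_pos q (s + 1)
        have h1 := mul_le_mul_of_nonneg_right (hcosSum (s + 1))
          (searchCost_nonneg hm₀pos.le (by linarith [hm1 (s + 1 + 1)] : 0 ≤ m (s + 1 + 1)))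
        have h2 := mul_le_mul_of_nonneg_left (hstep (s + 1)) hM0.le
        have h3 := mul_le_mul_of_nonneg_left (hMm1 (s + 1)) hM0.le
        nlinarith

/-! ### Expected cost of minimum finding -/

/-- A bound on the expected number of oracle calls of minimum finding when `t` of `2 ^ q` addresses
are marked. -/
noncomputable def minimumCost (q t : ℕ) : ℝ :=
  if t = 0 then 0 else 45 / 8 * √(2 ^ q) * (2 - 1 / √t)

theorem minimumCost_zero (q : ℕ) : minimumCost q 0 = 0 := if_pos rfl

theorem minimumCost_mono (q : ℕ) : Monotone (minimumCost q) := by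
  intro s t hst
  unfold minimumCost
  rcases Nat.eq_zero_or_pos t with ht | ht
  · have : s = 0 := by omega
    rw [if_pos ht, if_pos this]
  · rw [if_neg ht.ne']
    have ht1 : 1 ≤ √(t : ℝ) := Real.one_le_sqrt.2 (by exact_mod_cast ht)
    split_ifs with hs
    · have : 1 / √(t : ℝ) ≤ 1 := by rw [div_le_one (by linarith)]; exact ht1
      have : 0 ≤ 2 - 1 / √(t : ℝ) := by linarith
      positivity
    · have hs' : 0 < √(s : ℝ) := Real.sqrt_pos.2 (by exact_mod_cast Nat.pos_of_ne_zero hs)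
      have : 1 / √(t : ℝ) ≤ 1 / √(s : ℝ) :=
        one_div_le_one_div_of_le hs' (Real.sqrt_le_sqrt (by exact_mod_cast hst))
      exact mul_le_mul_of_nonneg_left (by linarith) (by positivity)

theorem minimumCost_nonneg (q t : ℕ) : 0 ≤ minimumCost q t := by
  rw [← minimumCost_zero q]
  exact minimumCost_mono q (Nat.zero_le t)

theorem minimumCost_le (q t : ℕ) : minimumCost q t ≤ 45 / 4 * √(2 ^ q) := by
  unfold minimumCost
  split_ifs
  · positivity
  · have : 0 ≤ 1 / √(t : ℝ) := by positivity
    have h := Real.sqrt_nonneg ((2 : ℝ) ^ q)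
    nlinarith [mul_nonneg h this]

/-- This compares the sum of 1/√j with an integral, in the form 2(√(j+1) - √j) ≤ 1/√j. -/
theorem sum_minimumCost_le (q t : ℕ) :
    ∑ j ∈ Finset.range (t + 1), minimumCost q j ≤
      45 / 8 * √(2 ^ q) * (2 * (t + 1) - 2 * √(t + 1)) := by
  induction t with
  | zero => simp [minimumCost_zero]
  | succ t ih =>
    rw [Finset.sum_range_succ]
    have e : minimumCost q (t + 1) = 45 / 8 * √(2 ^ q) * (2 - 1 / √((t : ℝ) + 1)) := by
      unfold minimumCost
      rw [if_neg (Nat.succ_ne_zero t)]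
      push_cast
      rfl
    rw [e]
    have h : 2 - 1 / √((t : ℝ) + 1) ≤ 2 - 2 * (√((t : ℝ) + 1 + 1) - √((t : ℝ) + 1)) := by
      have h1 : 0 < √((t : ℝ) + 1) := Real.sqrt_pos.2 (by positivity)
      have h2 : √((t : ℝ) + 1) ≤ √((t : ℝ) + 1 + 1) := Real.sqrt_le_sqrt (by linarith)
      have h3 : √((t : ℝ) + 1) ^ 2 = t + 1 := Real.sq_sqrt (by positivity)
      have h4 : √((t : ℝ) + 1 + 1) ^ 2 = t + 1 + 1 := Real.sq_sqrt (by positivity)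
      have : 2 * (√((t : ℝ) + 1 + 1) - √((t : ℝ) + 1)) ≤ 1 / √((t : ℝ) + 1) := by
        rw [le_div_iff₀ h1]
        nlinarith
      linarith
    have h' := mul_le_mul_of_nonneg_left h
      (by positivity : (0 : ℝ) ≤ 45 / 8 * √((2 : ℝ) ^ q))
    push_cast
    nlinarith

/-- The recurrence for minimum finding: one search, then a state of uniformly random lower rank. The
average is at most (45/8)√N(2 - 2/√t), and the search adds back half of the deficit. -/
theorem minimumCost_average (q t : ℕ) (ht : 0 < t) :
    45 / 8 * √(2 ^ q) / √t + (∑ j ∈ Finset.range t, minimumCost q j) / t ≤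
      minimumCost q t := by
  obtain ⟨t, rfl⟩ := Nat.exists_eq_add_of_le' ht
  have h := sum_minimumCost_le q t
  have h1 : 0 < √((t : ℝ) + 1) := Real.sqrt_pos.2 (by positivity)
  have h3 : √((t : ℝ) + 1) * √((t : ℝ) + 1) = t + 1 := Real.mul_self_sqrt (by positivity)
  have h4 : (∑ j ∈ Finset.range (t + 1), minimumCost q j) / ((t + 1 : ℕ) : ℝ) ≤
      45 / 8 * √(2 ^ q) * (2 - 2 / √((t : ℝ) + 1)) := by
    push_cast
    rw [div_le_iff₀ (by positivity)]
    refine h.trans (le_of_eq ?_)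
    have : 2 / √((t : ℝ) + 1) * (t + 1) = 2 * √((t : ℝ) + 1) := by
      nth_rewrite 2 [← h3]
      field_simp
    linear_combination (45 / 8 * √((2 : ℝ) ^ q)) * this
  refine (add_le_add_right h4 _).trans (le_of_eq ?_)
  unfold minimumCost
  rw [if_neg (Nat.succ_ne_zero t)]
  push_cast
  ring

/-- For distinct values the ranks are 0, …, |S| - 1 and equality holds; ties only lower ranks. The
induction adds an element of maximal value, which leaves the ranks of the others unchanged. -/
theorem sum_card_filter_lt_le {α : Type*} (f : α → ℝ) {B : ℕ → ℝ} (hB : Monotone B)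
    (S : Finset α) :
    ∑ a ∈ S, B (S.filter fun b => f b < f a).card ≤ ∑ j ∈ Finset.range S.card, B j := by
  classical
  induction S using Finset.induction_on_max_value f with
  | empty => simp
  | insert a S ha hmax ih =>
    rw [Finset.sum_insert ha, Finset.card_insert_of_notMem ha, Finset.sum_range_succ, add_comm]
    refine add_le_add (le_trans (Finset.sum_le_sum fun x hx => ?_) ih) (hB ?_)
    · rw [Finset.filter_insert, if_neg (not_lt.2 (hmax x hx))]
    · rw [Finset.filter_insert, if_neg (lt_irrefl _)]
      exact Finset.card_filter_le _ _

end QTrack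

namespace QTrack

/-! ### Randomized programs -/

section Run

variable {α β : Type}

/-- The joint distribution of the result and the running time. -/
noncomputable def Run.dist (p : Run α) : PMF (α × ℕ) := p

theorem Run.dist_bind (p : Run α) (f : α → Run β) :
    (p >>= f).dist = p.dist.bind fun r => (f r.1).dist.map fun s => (s.1, r.2 + s.2) := rfl

theorem Run.dist_pure (a : α) : (pure a : Run α).dist = PMF.pure (a, 0) := rfl

theorem Run.dist_tick (k : ℕ) : (tick k).dist = PMF.pure ((), k) := rfl

theorem Run.dist_uniform (k c : ℕ) : (uniform k c).dist =
    (PMF.uniformOfFintype (Fin (k - 1 + 1))).map fun i : Fin (k - 1 + 1) => ((i : ℕ), c) := rfl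

theorem Run.dist_runCircuit {q b : ℕ} (L : ℕ) (mem : Memory q b) (c : Circuit q b) :
    (runCircuit L mem c).dist = (c.measure mem).map fun a => (a, c.time L) := rfl

/-- The probability that the result of a program does not have a property. -/
noncomputable def failure (p : Run α) (G : α → Prop) : ℝ≥0∞ :=
  p.dist.toOuterMeasure {r | ¬ G r.1}

/-- Every possible pair of a result and a running time satisfies `Q`. -/
def Surely (p : Run α) (Q : α → ℕ → Prop) : Prop := ∀ r ∈ p.dist.support, Q r.1 r.2

theorem failure_bind (p : Run α) (f : α → Run β) (G : β → Prop) :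
    failure (p >>= f) G = ∑' r : α × ℕ, p.dist r * failure (f r.1) G := by
  unfold failure
  rw [Run.dist_bind, PMF.toOuterMeasure_bind_apply]
  refine tsum_congr fun r => ?_
  rw [PMF.toOuterMeasure_map_apply]
  rfl

theorem failure_pure_of {G : α → Prop} {a : α} (h : G a) : failure (pure a) G = 0 := by
  unfold failure
  rw [Run.dist_pure, PMF.toOuterMeasure_pure_apply]
  simp [h]

theorem failure_le_one (p : Run α) (G : α → Prop) : failure p G ≤ 1 := by
  unfold failure
  rw [PMF.toOuterMeasure_apply, ← PMF.tsum_coe p.dist]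
  exact ENNReal.tsum_le_tsum fun x => Set.indicator_le_self _ _ _

theorem failure_mono (p : Run α) {G G' : α → Prop} (h : ∀ a, G a → G' a) :
    failure p G' ≤ failure p G :=
  p.dist.toOuterMeasure.mono fun _ hr hG => hr (h _ hG)

theorem failure_eq_zero_of_surely {p : Run α} {G : α → Prop} (h : Surely p fun a _ => G a) :
    failure p G = 0 := by
  unfold failure
  rw [PMF.toOuterMeasure_apply_eq_zero_iff, Set.disjoint_left]
  exact fun r hr hG => hG (h r hr)

theorem failure_tick_bind (k : ℕ) (f : Unit → Run β) (G : β → Prop) :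
    failure (tick k >>= f) G = failure (f ()) G := by
  rw [failure_bind, tsum_eq_single ((), k)]
  · rw [Run.dist_tick, PMF.pure_apply_self, one_mul]
  · intro r hr
    rw [Run.dist_tick, PMF.pure_apply_of_ne _ _ hr, zero_mul]

theorem failure_bind_of_dist_eq_map {ι : Type} {p : Run α} {p' : PMF ι} {g : ι → α} {c : ℕ}
    (h : p.dist = p'.map fun i => (g i, c)) (f : α → Run β) (G : β → Prop) :
    failure (p >>= f) G = ∑' i, p' i * failure (f (g i)) G := by
  unfold failure
  rw [Run.dist_bind, h, PMF.bind_map, PMF.toOuterMeasure_bind_apply]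
  refine tsum_congr fun r => ?_
  simp only [Function.comp]
  rw [PMF.toOuterMeasure_map_apply]
  rfl

theorem failure_uniform_bind {k : ℕ} (hk : 0 < k) (c : ℕ) (f : ℕ → Run β) (G : β → Prop) :
    failure (uniform k c >>= f) G = ∑ i ∈ Finset.range k, (k : ℝ≥0∞)⁻¹ * failure (f i) G := by
  have h := failure_bind_of_dist_eq_map (Run.dist_uniform k c) f G
  rw [tsum_fintype] at h
  refine h.trans ?_
  have e : k - 1 + 1 = k := by omega
  simp only [PMF.uniformOfFintype_apply, Fintype.card_fin]
  rw [Fin.sum_univ_eq_sum_range (fun i => ((k - 1 + 1 : ℕ) : ℝ≥0∞)⁻¹ * failure (f i) G), e]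

theorem failure_runCircuit_bind {q b : ℕ} (L : ℕ) (mem : Memory q b) (c : Circuit q b)
    (f : (Fin q → Bool) → Run β) (G : β → Prop) :
    failure (runCircuit L mem c >>= f) G = ∑ a, c.measure mem a * failure (f a) G := by
  have h := failure_bind_of_dist_eq_map (Run.dist_runCircuit L mem c) f G
  rw [tsum_fintype] at h
  exact h

/-- Union bound: either the first stage misses `G`, or the second fails after it. -/
theorem failure_bind_le {p : Run α} {f : α → Run β} {G : α → Prop} {G' : β → Prop} {ε : ℝ≥0∞}
    (h : ∀ a, G a → failure (f a) G' ≤ ε) :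
    failure (p >>= f) G' ≤ failure p G + ε := by
  rw [failure_bind]
  unfold failure at *
  rw [PMF.toOuterMeasure_apply]
  have hone : ∑' r, p.dist r * ε = ε := by
    rw [ENNReal.tsum_mul_right, PMF.tsum_coe, one_mul]
  rw [← hone, ← ENNReal.tsum_add]
  refine ENNReal.tsum_le_tsum fun r => ?_
  by_cases hr : G r.1
  · exact (mul_le_mul_right (h _ hr) _).trans le_add_self
  · have : r ∈ {r : α × ℕ | ¬ G r.1} := hr
    rw [Set.indicator_of_mem this]
    refine le_trans ?_ le_self_add
    exact (mul_le_mul_right (failure_le_one (f r.1) G') _).trans (by rw [mul_one])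

/-- If success of the first stage suffices, both stages must fail. The sure property `V` restricts
the results for which the second stage has to be controlled. -/
theorem failure_bind_mul_le {p : Run α} {f : α → Run β} {V G : α → Prop} {G' : β → Prop}
    {ε : ℝ≥0∞} (hV : Surely p fun a _ => V a) (h0 : ∀ a, G a → failure (f a) G' = 0)
    (h : ∀ a, V a → failure (f a) G' ≤ ε) :
    failure (p >>= f) G' ≤ failure p G * ε := by
  rw [failure_bind]
  unfold failure at *
  rw [PMF.toOuterMeasure_apply, ← ENNReal.tsum_mul_right]
  refine ENNReal.tsum_le_tsum fun r => ?_
  by_cases hr : G r.1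
  · rw [h0 _ hr, mul_zero]; exact zero_le
  · have : r ∈ {r : α × ℕ | ¬ G r.1} := hr
    rw [Set.indicator_of_mem this]
    by_cases hs : r ∈ p.dist.support
    · exact mul_le_mul_right (h _ (hV r hs)) _
    · have : p.dist r = 0 := (PMF.apply_eq_zero_iff _ _).2 hs
      rw [this, zero_mul]; exact zero_le

theorem surely_pure {a : α} {Q : α → ℕ → Prop} (h : Q a 0) : Surely (pure a) Q := by
  intro r hr
  rw [Run.dist_pure, PMF.mem_support_pure_iff] at hr
  subst hr
  exact h

theorem surely_bind {p : Run α} {f : α → Run β} {Q : α → ℕ → Prop} {Q' : β → ℕ → Prop}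
    (hp : Surely p Q) (hf : ∀ a k, Q a k → Surely (f a) fun c m => Q' c (k + m)) :
    Surely (p >>= f) Q' := by
  intro r hr
  rw [Run.dist_bind, PMF.mem_support_bind_iff] at hr
  obtain ⟨a, ha, hr⟩ := hr
  rw [PMF.mem_support_map_iff] at hr
  obtain ⟨s, hs, rfl⟩ := hr
  exact hf a.1 a.2 (hp a ha) s hs

theorem surely_tick {k : ℕ} {Q : Unit → ℕ → Prop} (h : Q () k) : Surely (tick k) Q := by
  intro r hr
  rw [Run.dist_tick, PMF.mem_support_pure_iff] at hr
  subst hr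
  exact h

theorem surely_uniform {k : ℕ} (hk : 0 < k) (c : ℕ) {Q : ℕ → ℕ → Prop} (h : ∀ i < k, Q i c) :
    Surely (uniform k c) Q := by
  intro r hr
  rw [Run.dist_uniform, PMF.mem_support_map_iff] at hr
  obtain ⟨i, _, rfl⟩ := hr
  exact h _ (by omega)

theorem surely_runCircuit {q b : ℕ} (L : ℕ) (mem : Memory q b) (c : Circuit q b)
    {Q : (Fin q → Bool) → ℕ → Prop} (h : ∀ a, Q a (c.time L)) :
    Surely (runCircuit L mem c) Q := by
  intro r hr
  rw [Run.dist_runCircuit, PMF.mem_support_map_iff] at hr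
  obtain ⟨a, _, rfl⟩ := hr
  exact h a

theorem Surely.mono {p : Run α} {Q Q' : α → ℕ → Prop} (hp : Surely p Q)
    (h : ∀ a k, Q a k → Q' a k) : Surely p Q' := fun r hr => h _ _ (hp r hr)

end Run

/-! ### Bounds for the states of minimum finding -/

theorem exists_groverAngle (q t : ℕ) (htN : t ≤ 2 ^ q) :
    ∃ θ : ℝ, √(2 ^ q) * Real.sin θ = √t ∧ √(2 ^ q) * Real.cos θ = √(2 ^ q - t) := by
  have hN : (0 : ℝ) < 2 ^ q := by positivity
  have htN' : (t : ℝ) ≤ 2 ^ q := by exact_mod_cast htN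
  have hR : 0 < √((2 : ℝ) ^ q) := Real.sqrt_pos.2 hN
  refine ⟨Real.arcsin (√t / √(2 ^ q)), ?_, ?_⟩
  · rw [Real.sin_arcsin]
    · field_simp
    · have : 0 ≤ √(t : ℝ) / √(2 ^ q) := by positivity
      linarith
    · rw [div_le_one hR]
      exact Real.sqrt_le_sqrt htN'
  · rw [Real.cos_arcsin, ← Real.sqrt_mul hN.le, div_pow, Real.sq_sqrt (by positivity),
      Real.sq_sqrt hN.le]
    congr 1
    field_simp

/-- Bounds `Φ t s` on the expected number of further oracle calls of minimum finding when `t`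
addresses are marked and the current search has failed `s` times. -/
theorem exists_stateCost (q : ℕ) : ∃ Φ : ℕ → ℕ → ℝ, (∀ t s, 0 ≤ Φ t s) ∧ (∀ s, Φ 0 s = 0) ∧
    (∀ t ≤ 2 ^ q, Φ t 0 ≤ minimumCost q t) ∧
    ∀ t : ℕ, 0 < t → t ≤ 2 ^ q → ∃ θ : ℝ, √(2 ^ q) * Real.sin θ = √t ∧
      √(2 ^ q) * Real.cos θ = √(2 ^ q - t) ∧
      ∀ s, ∑ k ∈ Finset.range (iterationChoices q s), (((k : ℝ) + 1) +
        Real.sin ((2 * k + 1) * θ) ^ 2 * ((∑ j ∈ Finset.range t, minimumCost q j) / t) +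
        Real.cos ((2 * k + 1) * θ) ^ 2 * Φ t (s + 1)) ≤ iterationChoices q s * Φ t s := by
  have key : ∀ t : ℕ, ∃ Φ : ℕ → ℝ, (∀ s, 0 ≤ Φ s) ∧ (t = 0 → ∀ s, Φ s = 0) ∧
    (t ≤ 2 ^ q → Φ 0 ≤ minimumCost q t) ∧
    (0 < t → t ≤ 2 ^ q → ∃ θ : ℝ, √(2 ^ q) * Real.sin θ = √t ∧
      √(2 ^ q) * Real.cos θ = √(2 ^ q - t) ∧
      ∀ s, ∑ k ∈ Finset.range (iterationChoices q s), (((k : ℝ) + 1) +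
        Real.sin ((2 * k + 1) * θ) ^ 2 * ((∑ j ∈ Finset.range t, minimumCost q j) / t) +
        Real.cos ((2 * k + 1) * θ) ^ 2 * Φ (s + 1)) ≤ iterationChoices q s * Φ s) := by
    intro t
    by_cases ht : 0 < t ∧ t ≤ 2 ^ q
    · obtain ⟨ht, htN⟩ := ht
      obtain ⟨θ, hsin, hcos⟩ := exists_groverAngle q t htN
      obtain ⟨τ, hτ, hτ0, hτs⟩ := exists_searchCost q t ht htN θ hsin hcos
      set A := (∑ j ∈ Finset.range t, minimumCost q j) / t with hA
      have hA0 : 0 ≤ A := div_nonneg (Finset.sum_nonneg fun j _ => minimumCost_nonneg q j)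
        (Nat.cast_nonneg t)
      -- `A` is the mean cost after a hit has been found. It does not depend on `s`, and since sin²
      -- + cos² = 1 it passes unchanged through the recursion for `τ`.
      refine ⟨fun s => τ s + A, fun s => add_nonneg (hτ s) hA0, fun h => absurd h ht.ne',
        fun _ => ?_, fun _ _ => ⟨θ, hsin, hcos, fun s => ?_⟩⟩
      · have := minimumCost_average q t ht
        dsimp only
        linarith
      · have e : ∀ k ∈ Finset.range (iterationChoices q s), (((k : ℝ) + 1) +
            Real.sin ((2 * k + 1) * θ) ^ 2 * A +
            Real.cos ((2 * k + 1) * θ) ^ 2 * (τ (s + 1) + A)) =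
            (((k : ℝ) + 1) + Real.cos ((2 * k + 1) * θ) ^ 2 * τ (s + 1)) + A := by
          intro k _
          linear_combination A * Real.sin_sq_add_cos_sq ((2 * k + 1) * θ)
        rw [Finset.sum_congr rfl e, Finset.sum_add_distrib, Finset.sum_const, Finset.card_range,
          nsmul_eq_mul, mul_add]
        have := hτs s
        linarith
    · exact ⟨fun _ => 0, fun _ => le_rfl, fun _ _ => rfl, fun _ => minimumCost_nonneg q t,
        fun h h' => absurd ⟨h, h'⟩ ht⟩
  choose Φ h1 h2 h3 h4 using key
  exact ⟨Φ, h1, fun s => h2 0 rfl s, h3, h4⟩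

/-- The induction step of Markov's inequality. -/
theorem le_ofReal_add_div {x : ℝ≥0∞} {R c Φ : ℝ} (hR : 0 < R) (hc : 0 < c) (hΦ : 0 ≤ Φ)
    (hx : x ≤ 1) (h : c < R → x ≤ ENNReal.ofReal (Φ / (R - c))) :
    x ≤ ENNReal.ofReal ((c + Φ) / R) := by
  by_cases hle : R ≤ c + Φ
  · refine hx.trans ?_
    rw [← ENNReal.ofReal_one]
    exact ENNReal.ofReal_le_ofReal ((one_le_div hR).2 hle)
  · push Not at hle
    have hcR : c < R := by linarith
    refine (h hcR).trans (ENNReal.ofReal_le_ofReal ?_)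
    -- Cross-multiplied, the claim is c(c + Φ) ≤ cR.
    rw [div_le_div_iff₀ (by linarith) hR]
    nlinarith

/-! ### Minimum finding -/

section Minimum

variable {n b : ℕ} (L : ℕ) (D : Model b) (ev : EventRecord n b) (l : ℕ) (t : Track n)
  (used : List (Fin n))

/-- A result of minimum finding is a good hit, or no hit. -/
def IsCandidate (r : Option (Fin n × (Fin b → Bool))) : Prop :=
  ∀ h, r = some h → (∃ a, hitAt ev l used a = some h) ∧ chi2 D l t h.2 < D.chi0

/-- A result of minimum finding is a good hit with minimal `χ²`, or no hit if there is no good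
hit. -/
def IsMinimum (r : Option (Fin n × (Fin b → Bool))) : Prop :=
  IsCandidate D ev l t used r ∧ ∀ a h', hitAt ev l used a = some h' → chi2 D l t h'.2 < D.chi0 →
    ∃ h, r = some h ∧ chi2 D l t h.2 ≤ chi2 D l t h'.2

/-- The threshold of minimum finding when `best` is the last remembered hit. -/
noncomputable def threshold (best : Option (Fin n × (Fin b → Bool))) : ℝ :=
  best.elim D.chi0 fun h => chi2 D l t h.2

/-- The addresses of the hits with `χ² < y`. -/
noncomputable def addressesBelow (y : ℝ) : Finset (Fin (addrBits n) → Bool) :=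
  markedAddresses (memory ev l used) (markedCells D l t y)

theorem mem_addressesBelow (y : ℝ) (a : Fin (addrBits n) → Bool) :
    a ∈ addressesBelow D ev l t used y ↔
      ∃ h, hitAt ev l used a = some h ∧ chi2 D l t h.2 < y := by
  rw [addressesBelow, mem_markedAddresses]
  unfold memory markedCells
  rcases hitAt ev l used a with _ | h
  · simp
  · simp

/-- After a success the number of marked addresses is the rank of the hit found, in the form of
`sum_card_filter_lt_le`. The value `threshold` gives to addresses without a hit is irrelevant, as
these are never marked. -/
theorem addressesBelow_chi2 {y : ℝ} {a : Fin (addrBits n) → Bool} {h : Fin n × (Fin b → Bool)}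
    (ha : hitAt ev l used a = some h) (hy : chi2 D l t h.2 < y) :
    addressesBelow D ev l t used (chi2 D l t h.2) =
      (addressesBelow D ev l t used y).filter fun a' =>
        threshold D l t (hitAt ev l used a') < threshold D l t (hitAt ev l used a) := by
  ext a'
  rw [Finset.mem_filter, mem_addressesBelow, mem_addressesBelow, ha]
  constructor
  · rintro ⟨h', e, hlt⟩
    exact ⟨⟨h', e, hlt.trans hy⟩, by rw [e]; exact hlt⟩
  · rintro ⟨⟨h', e, _⟩, hlt⟩
    rw [e] at hlt
    exact ⟨h', e, hlt⟩

theorem isMinimum_of_card_eq_zero {best : Option (Fin n × (Fin b → Bool))}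
    (hbest : IsCandidate D ev l t used best)
    (h : (addressesBelow D ev l t used (threshold D l t best)).card = 0) :
    IsMinimum D ev l t used best := by
  rw [Finset.card_eq_zero] at h
  refine ⟨hbest, fun a h' ha hlt => ?_⟩
  have hn : ¬ chi2 D l t h'.2 < threshold D l t best := by
    intro hc
    have := (mem_addressesBelow D ev l t used _ a).2 ⟨h', ha, hc⟩
    rw [h] at this
    exact Finset.notMem_empty _ this
  rcases best with _ | h0
  · exact absurd hlt hn
  · exact ⟨h0, rfl, not_lt.1 hn⟩

theorem card_addressesBelow_le (y : ℝ) :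
    (addressesBelow D ev l t used y).card ≤ 2 ^ addrBits n := by
  have := Finset.card_le_univ (addressesBelow D ev l t used y)
  rwa [Fintype.card_fun, Fintype.card_bool, Fintype.card_fin] at this

/-- One attempt of minimum finding. -/
theorem sum_measure_mul_le (mem : Memory (addrBits n) b) (marked : Finset (Fin (b + 1) → Bool))
    (ht : 0 < (markedAddresses mem marked).card) (θ : ℝ)
    (hsin : √(2 ^ addrBits n) * Real.sin θ = √((markedAddresses mem marked).card))
    (hcos : √(2 ^ addrBits n) * Real.cos θ =
      √(2 ^ addrBits n - (markedAddresses mem marked).card)) (k : ℕ)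
    (x : (Fin (addrBits n) → Bool) → ℝ≥0∞) (u : (Fin (addrBits n) → Bool) → ℝ) (v R : ℝ)
    (hR : 0 < R) (hu : ∀ a, 0 ≤ u a) (hv : 0 ≤ v)
    (hxu : ∀ a ∈ markedAddresses mem marked, x a ≤ ENNReal.ofReal ((k + 1 + u a) / R))
    (hxv : ∀ a ∉ markedAddresses mem marked, x a ≤ ENNReal.ofReal ((k + 1 + v) / R)) :
    ∑ a, (grover (addrBits n) marked k).measure mem a * x a ≤
      ENNReal.ofReal ((((k : ℝ) + 1) + Real.sin ((2 * k + 1) * θ) ^ 2 *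
        ((∑ a ∈ markedAddresses mem marked, u a) / (markedAddresses mem marked).card) +
          Real.cos ((2 * k + 1) * θ) ^ 2 * v) / R) := by
  classical
  set S := markedAddresses mem marked with hS
  set p := (grover (addrBits n) marked k).measure mem with hp
  set σ := Real.sin ((2 * k + 1) * θ) ^ 2 with hσ
  have hσ0 : 0 ≤ σ := sq_nonneg _
  have hσ1 : σ ≤ 1 := Real.sin_sq_le_one _
  have hcs : Real.cos ((2 * k + 1) * θ) ^ 2 = 1 - σ := by rw [hσ, Real.cos_sq']
  have htr : (0 : ℝ) < S.card := by exact_mod_cast ht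
  have hpS : ∀ a ∈ S, p a = ENNReal.ofReal (σ / S.card) := fun a ha =>
    measure_grover mem marked ht θ hsin hcos k a ha
  have hsumS : ∑ a ∈ S, p a = ENNReal.ofReal σ := by
    rw [Finset.sum_congr rfl hpS, Finset.sum_const, nsmul_eq_mul, ← ENNReal.ofReal_natCast,
      ← ENNReal.ofReal_mul (by positivity)]
    congr 1
    field_simp
  -- Unmarked outcomes all lead to the same bound, so only their total probability matters.
  have hsumC : ∑ a ∈ Sᶜ, p a = ENNReal.ofReal (1 - σ) := by
    have h1 : ∑ a ∈ S, p a + ∑ a ∈ Sᶜ, p a = 1 := by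
      rw [Finset.sum_add_sum_compl]
      exact (tsum_fintype _).symm.trans (PMF.tsum_coe p)
    rw [hsumS] at h1
    rw [ENNReal.ofReal_sub _ hσ0, ENNReal.ofReal_one]
    exact ENNReal.eq_sub_of_add_eq ENNReal.ofReal_ne_top (by rw [add_comm]; exact h1)
  rw [← Finset.sum_add_sum_compl S]
  have h1 : ∑ a ∈ S, p a * x a ≤
      ENNReal.ofReal (∑ a ∈ S, σ / S.card * ((k + 1 + u a) / R)) := by
    rw [ENNReal.ofReal_sum_of_nonneg fun a _ => by have := hu a; positivity]
    refine Finset.sum_le_sum fun a ha => ?_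
    rw [hpS a ha, ENNReal.ofReal_mul (by positivity)]
    exact mul_le_mul_right (hxu a ha) _
  have h2 : ∑ a ∈ Sᶜ, p a * x a ≤ ENNReal.ofReal ((1 - σ) * ((k + 1 + v) / R)) := by
    rw [ENNReal.ofReal_mul (by linarith), ← hsumC, Finset.sum_mul]
    exact Finset.sum_le_sum fun a ha => mul_le_mul_right (hxv a (Finset.mem_compl.1 ha)) _
  refine (add_le_add h1 h2).trans ?_
  rw [← ENNReal.ofReal_add]
  · refine ENNReal.ofReal_le_ofReal (le_of_eq ?_)
    rw [← Finset.mul_sum, ← Finset.sum_div, Finset.sum_add_distrib, Finset.sum_const, nsmul_eq_mul,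
      hcs]
    field_simp
    ring
  · exact Finset.sum_nonneg fun a _ => by have := hu a; positivity
  · have : 0 ≤ 1 - σ := by linarith
    positivity

/-- Markov's inequality carried through the loop: with R calls left and a bound Φ on the mean number
still needed, failure has probability at most Φ/R. The induction is on the remaining budget and
averages over k and over the measured address. -/
theorem failure_minimumLoop_le (Φ : ℕ → ℕ → ℝ) (h0 : ∀ t s, 0 ≤ Φ t s) (hz : ∀ s, Φ 0 s = 0)
    (hm : ∀ t ≤ 2 ^ addrBits n, Φ t 0 ≤ minimumCost (addrBits n) t)
    (hs : ∀ t : ℕ, 0 < t → t ≤ 2 ^ addrBits n → ∃ θ : ℝ, √(2 ^ addrBits n) * Real.sin θ = √t ∧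
      √(2 ^ addrBits n) * Real.cos θ = √(2 ^ addrBits n - t) ∧
      ∀ s, ∑ k ∈ Finset.range (iterationChoices (addrBits n) s), (((k : ℝ) + 1) +
        Real.sin ((2 * k + 1) * θ) ^ 2 *
          ((∑ j ∈ Finset.range t, minimumCost (addrBits n) j) / t) +
        Real.cos ((2 * k + 1) * θ) ^ 2 * Φ t (s + 1)) ≤
          iterationChoices (addrBits n) s * Φ t s) (m : ℕ) :
    ∀ (calls s : ℕ) (best : Option (Fin n × (Fin b → Bool))), callLimit n - calls = m →
      IsCandidate D ev l t used best → calls < callLimit n →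
      failure (minimumLoop L D ev l t used calls s (threshold D l t best) best)
        (IsMinimum D ev l t used) ≤
      ENNReal.ofReal (Φ (addressesBelow D ev l t used (threshold D l t best)).card s /
        ((callLimit n : ℝ) - calls)) := by
  induction m using Nat.strong_induction_on with
  | _ m ih =>
  intro calls s best hcm hbest hc
  set y := threshold D l t best with hy
  set S := addressesBelow D ev l t used y with hS
  set R : ℝ := (callLimit n : ℝ) - calls with hRdef
  have hR : 0 < R := by
    have : (calls : ℝ) < callLimit n := by exact_mod_cast hc
    linarith
  have hq : ∀ k : ℕ, ((callLimit n : ℝ) - (calls + k + 1 : ℕ)) = R - (k + 1) := by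
    intro k; rw [hRdef]; push_cast; ring
  have hlt : ∀ k : ℕ, ((k : ℝ) + 1 < R) → calls + k + 1 < callLimit n := by
    intro k hk
    have h1 : ((calls + k + 1 : ℕ) : ℝ) < callLimit n := by push_cast; linarith
    exact_mod_cast h1
  -- An attempt with k iterations uses k + 1 calls. If these exhaust the budget, the bound is at
  -- least 1 and hence trivial.
  have hne : ∀ k : ℕ, failure (minimumLoop L D ev l t used (calls + k + 1) (s + 1) y best)
      (IsMinimum D ev l t used) ≤ ENNReal.ofReal ((k + 1 + Φ S.card (s + 1)) / R) := by
    intro k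
    refine le_ofReal_add_div hR (by positivity) (h0 _ _) (failure_le_one _ _) fun hk => ?_
    rw [← hq]
    exact ih _ (by omega) _ (s + 1) best rfl hbest (hlt k hk)
  have hyes : ∀ (k : ℕ) (h : Fin n × (Fin b → Bool)), IsCandidate D ev l t used (some h) →
      failure (minimumLoop L D ev l t used (calls + k + 1) 0 (chi2 D l t h.2) (some h))
        (IsMinimum D ev l t used) ≤ ENNReal.ofReal ((k + 1 + minimumCost (addrBits n)
          (addressesBelow D ev l t used (chi2 D l t h.2)).card) / R) := by
    intro k h hh
    refine le_ofReal_add_div hR (by positivity) (minimumCost_nonneg _ _) (failure_le_one _ _)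
      fun hk => ?_
    rw [← hq]
    refine (ih _ (by omega) _ 0 (some h) rfl hh (hlt k hk)).trans (ENNReal.ofReal_le_ofReal ?_)
    have hpos : 0 < (callLimit n : ℝ) - (calls + k + 1 : ℕ) := by rw [hq]; linarith
    exact div_le_div_of_nonneg_right (hm _ (card_addressesBelow_le D ev l t used _)) hpos.le
  have hyle : y ≤ D.chi0 := by
    rcases hb : best with _ | h
    · rw [hy, hb]; rfl
    · rw [hy, hb]; exact (hbest h hb).2.le
  have hM := iterationChoices_pos (addrBits n) s
  rw [minimumLoop.eq_def, dif_pos hc, failure_uniform_bind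
    (show 0 < ⌈min ((6 / 5 : ℝ) ^ s) (Real.sqrt (2 ^ addrBits n))⌉₊ from hM)]
  change ∑ k ∈ Finset.range (iterationChoices (addrBits n) s),
    (iterationChoices (addrBits n) s : ℝ≥0∞)⁻¹ * _ ≤ _
  -- When nothing lies below the threshold, the remembered result is already a minimum and is never
  -- replaced.
  rcases Nat.eq_zero_or_pos S.card with hcard | hcard
  · have hmin : IsMinimum D ev l t used best :=
      isMinimum_of_card_eq_zero D ev l t used hbest hcard
    have hnext : ∀ k : ℕ, failure (minimumLoop L D ev l t used (calls + k + 1) (s + 1) y best)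
        (IsMinimum D ev l t used) = 0 := by
      intro k
      by_cases hk : calls + k + 1 < callLimit n
      · refine nonpos_iff_eq_zero.1 ((ih _ (by omega) _ (s + 1) best rfl hbest hk).trans ?_)
        rw [hcard, hz]
        simp
      · rw [minimumLoop.eq_def, dif_neg hk]
        exact failure_pure_of hmin
    refine le_of_eq_of_le (Finset.sum_eq_zero fun k _ => ?_) zero_le
    rw [failure_runCircuit_bind]
    refine mul_eq_zero_of_right _ (Finset.sum_eq_zero fun a _ => mul_eq_zero_of_right _ ?_)
    rw [failure_tick_bind]
    rcases ha : hitAt ev l used a with _ | h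
    · exact hnext k
    · have : ¬ chi2 D l t h.2 < y := by
        intro hlt
        have := (mem_addressesBelow D ev l t used y a).2 ⟨h, ha, hlt⟩
        rw [← hS, Finset.card_eq_zero.1 hcard] at this
        exact Finset.notMem_empty _ this
      simp only [if_neg this]
      exact hnext k
  · obtain ⟨θ, hsin, hcos, hsum⟩ := hs S.card hcard (card_addressesBelow_le D ev l t used y)
    set A := (∑ j ∈ Finset.range S.card, minimumCost (addrBits n) j) / S.card with hA
    set M := iterationChoices (addrBits n) s with hMdef
    have hM' : (0 : ℝ) < M := by exact_mod_cast hM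
    set X : ℕ → ℝ := fun k => ((k : ℝ) + 1) + Real.sin ((2 * k + 1) * θ) ^ 2 * A +
      Real.cos ((2 * k + 1) * θ) ^ 2 * Φ S.card (s + 1) with hX
    have hA0 : 0 ≤ A := div_nonneg (Finset.sum_nonneg fun j _ => minimumCost_nonneg _ j)
      (Nat.cast_nonneg _)
    have hX0 : ∀ k, 0 ≤ X k := fun k => by have := h0 S.card (s + 1); simp only [hX]; positivity
    have hstep : ∀ k ∈ Finset.range M, (M : ℝ≥0∞)⁻¹ * ENNReal.ofReal (X k / R) =
        ENNReal.ofReal ((M : ℝ)⁻¹ * (X k / R)) := by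
      intro k _
      rw [ENNReal.ofReal_mul (by positivity), ENNReal.ofReal_inv_of_pos hM',
        ENNReal.ofReal_natCast]
    have hfin : ∑ k ∈ Finset.range M, (M : ℝ≥0∞)⁻¹ * ENNReal.ofReal (X k / R) ≤
        ENNReal.ofReal (Φ S.card s / R) := by
      rw [Finset.sum_congr rfl hstep, ← ENNReal.ofReal_sum_of_nonneg
        fun k _ => mul_nonneg (by positivity) (div_nonneg (hX0 k) hR.le)]
      refine ENNReal.ofReal_le_ofReal ?_
      rw [← Finset.mul_sum, ← Finset.sum_div, ← mul_div_assoc]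
      refine div_le_div_of_nonneg_right ?_ hR.le
      rw [inv_mul_le_iff₀ hM']
      exact hsum s
    refine le_trans (Finset.sum_le_sum fun k _ => mul_le_mul_right ?_ _) hfin
    rw [failure_runCircuit_bind]
    -- A marked outcome `a` restarts the search with the threshold lowered to its χ², at a cost
    -- given by the rank of `a` in `S`.
    refine (sum_measure_mul_le (memory ev l used) (markedCells D l t y) hcard θ hsin hcos k _
      (fun a => minimumCost (addrBits n) (S.filter fun a' =>
        threshold D l t (hitAt ev l used a') < threshold D l t (hitAt ev l used a)).card)
      (Φ S.card (s + 1)) R hR (fun a => minimumCost_nonneg _ _) (h0 _ _) ?_ ?_).trans ?_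
    · intro a ha
      rw [failure_tick_bind]
      obtain ⟨h, e, hlt⟩ := (mem_addressesBelow D ev l t used y a).1 ha
      have e' := addressesBelow_chi2 D ev l t used e hlt
      rw [← hS] at e'
      rw [← e']
      simp only [e, if_pos hlt]
      refine hyes k h fun h' he => ?_
      cases he
      exact ⟨⟨a, e⟩, hlt.trans_le hyle⟩
    · intro a ha
      rw [failure_tick_bind]
      rcases e : hitAt ev l used a with _ | h
      · exact hne k
      · have : ¬ chi2 D l t h.2 < y := fun hlt =>
          ha ((mem_addressesBelow D ev l t used y a).2 ⟨h, e, hlt⟩)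
        simp only [if_neg this]
        exact hne k
    · refine ENNReal.ofReal_le_ofReal (div_le_div_of_nonneg_right ?_ hR.le)
      have hrank := sum_card_filter_lt_le (fun a => threshold D l t (hitAt ev l used a))
        (minimumCost_mono (addrBits n)) S
      have : (∑ a ∈ S, minimumCost (addrBits n) (S.filter fun a' =>
          threshold D l t (hitAt ev l used a') < threshold D l t (hitAt ev l used a)).card) /
          (S.card : ℝ) ≤ A := div_le_div_of_nonneg_right hrank (Nat.cast_nonneg _)
      have h2 := mul_le_mul_of_nonneg_left this (sq_nonneg (Real.sin ((2 * (k : ℝ) + 1) * θ)))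
      exact add_le_add (add_le_add le_rfl h2) le_rfl

/-- The mean cost is at most (45/4)√N, half of the call limit. -/
theorem failure_minimumFinding_le :
    failure (minimumFinding L D ev l t used) (IsMinimum D ev l t used) ≤ 2⁻¹ := by
  obtain ⟨Φ, h0, hz, hm, hs⟩ := exists_stateCost (addrBits n)
  have hR1 := one_le_sqrt_two_pow (addrBits n)
  have hlim : 45 / 2 * √(2 ^ addrBits n) ≤ (callLimit n : ℝ) := by
    refine le_trans (le_of_eq ?_) (Nat.le_ceil _)
    norm_num
  have hpos : (0 : ℝ) < callLimit n := by linarith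
  have h := failure_minimumLoop_le L D ev l t used Φ h0 hz hm hs _ 0 0 none rfl
    (fun h e => by cases e) (by exact_mod_cast hpos)
  refine h.trans ?_
  have e : (2⁻¹ : ℝ≥0∞) = ENNReal.ofReal (1 / 2) := by
    rw [one_div, ENNReal.ofReal_inv_of_pos (by norm_num)]
    norm_num
  rw [e]
  refine ENNReal.ofReal_le_ofReal ?_
  have h1 := (hm _ (card_addressesBelow_le D ev l t used (threshold D l t none))).trans
    (minimumCost_le (addrBits n) _)
  rw [Nat.cast_zero, sub_zero, div_le_iff₀ hpos]
  linarith

/-- Even a failed run returns a legitimate candidate, so it cannot spoil the minimum found by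
another run. -/
theorem surely_minimumLoop (m : ℕ) :
    ∀ (calls s : ℕ) (y : ℝ) (best : Option (Fin n × (Fin b → Bool))), callLimit n - calls = m →
      IsCandidate D ev l t used best → y ≤ D.chi0 →
      Surely (minimumLoop L D ev l t used calls s y best)
        fun r _ => IsCandidate D ev l t used r := by
  induction m using Nat.strong_induction_on with
  | _ m ih =>
  intro calls s y best hcm hbest hy
  rw [minimumLoop.eq_def]
  split_ifs with hc
  · refine surely_bind (Q := fun _ _ => True) (fun _ _ => trivial) fun k _ _ => ?_
    refine surely_bind (Q := fun _ _ => True) (fun _ _ => trivial) fun a _ _ => ?_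
    refine surely_bind (Q := fun _ _ => True) (fun _ _ => trivial) fun _ _ _ => ?_
    rcases e : hitAt ev l used a with _ | h
    · exact ih _ (by omega) _ _ _ _ rfl hbest hy
    · dsimp only
      split_ifs with hlt
      · refine ih _ (by omega) _ _ _ _ rfl (fun h' he => ?_) (hlt.le.trans hy)
        cases he
        exact ⟨⟨a, e⟩, hlt.trans_le hy⟩
      · exact ih _ (by omega) _ _ _ _ rfl hbest hy
  · exact surely_pure hbest

theorem surely_minimumFinding :
    Surely (minimumFinding L D ev l t used) fun r _ => IsCandidate D ev l t used r :=
  surely_minimumLoop L D ev l t used _ 0 0 _ none rfl (fun h e => by cases e) le_rfl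

/-! ### Amplification by repetition -/

variable {D ev l t used}

theorem IsCandidate.better {r r' : Option (Fin n × (Fin b → Bool))}
    (hr : IsCandidate D ev l t used r) (hr' : IsCandidate D ev l t used r') :
    IsCandidate D ev l t used (better D l t r r') := by
  rcases r with _ | h <;> rcases r' with _ | h'
  · exact hr'
  · exact hr'
  · exact hr
  · unfold QTrack.better
    dsimp only
    split_ifs
    · exact hr'
    · exact hr

theorem IsMinimum.better_left {r r' : Option (Fin n × (Fin b → Bool))}
    (hr : IsMinimum D ev l t used r) (hr' : IsCandidate D ev l t used r') :
    IsMinimum D ev l t used (better D l t r r') := by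
  refine ⟨hr.1.better hr', fun a h₁ ha hlt => ?_⟩
  obtain ⟨h, rfl, hle⟩ := hr.2 a h₁ ha hlt
  rcases r' with _ | h'
  · exact ⟨h, rfl, hle⟩
  · unfold better
    dsimp only
    split_ifs with hc
    · exact ⟨h', rfl, hc.le.trans hle⟩
    · exact ⟨h, rfl, hle⟩

theorem IsMinimum.better_right {r r' : Option (Fin n × (Fin b → Bool))}
    (hr : IsCandidate D ev l t used r) (hr' : IsMinimum D ev l t used r') :
    IsMinimum D ev l t used (better D l t r r') := by
  refine ⟨hr.better hr'.1, fun a h₁ ha hlt => ?_⟩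
  obtain ⟨h', rfl, hle⟩ := hr'.2 a h₁ ha hlt
  rcases r with _ | h
  · exact ⟨h', rfl, hle⟩
  · unfold better
    dsimp only
    split_ifs with hc
    · exact ⟨h', rfl, hle⟩
    · exact ⟨h, rfl, (not_lt.1 hc).trans hle⟩

variable (D ev l t used)

theorem surely_repeatedMinimum (k : ℕ) :
    Surely (repeatedMinimum L D ev l t used k) fun r _ => IsCandidate D ev l t used r := by
  induction k with
  | zero => exact surely_pure fun h e => by cases e
  | succ k ih =>
    refine surely_bind (surely_minimumFinding L D ev l t used) fun r _ hr => ?_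
    refine surely_bind ih fun r' _ hr' => ?_
    refine surely_bind (Q := fun _ _ => True) (fun _ _ => trivial) fun _ _ _ => ?_
    exact surely_pure (hr.better hr')

/-- A single successful run suffices, because `better` keeps a minimum against any candidate. -/
theorem failure_repeatedMinimum_le (k : ℕ) :
    failure (repeatedMinimum L D ev l t used k) (IsMinimum D ev l t used) ≤ 2⁻¹ ^ k := by
  induction k with
  | zero => exact (failure_le_one _ _).trans (by simp)
  | succ k ih =>
    rw [pow_succ']
    refine le_trans (failure_bind_mul_le (surely_minimumFinding L D ev l t used)
      (G := IsMinimum D ev l t used) (ε := 2⁻¹ ^ k) (fun r hr => ?_) fun r hr => ?_)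
      (mul_le_mul_left (failure_minimumFinding_le L D ev l t used) _)
    · refine failure_eq_zero_of_surely ?_
      refine surely_bind (surely_repeatedMinimum L D ev l t used k) fun r' _ hr' => ?_
      refine surely_bind (Q := fun _ _ => True) (fun _ _ => trivial) fun _ _ _ => ?_
      exact surely_pure (hr.better_left hr')
    · refine (failure_bind_le (G := IsMinimum D ev l t used) (ε := 0) fun r' hr' => ?_).trans ?_
      · rw [failure_tick_bind, failure_pure_of (IsMinimum.better_right hr hr')]
      · rw [add_zero]; exact ih

end Minimum

end QTrack

namespace QTrack

/-! ### Top parts of a list -/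

/-- `part` consists of entries of `full`, and every entry of `full` that is left out is dominated
by at least `k` entries of `part`. -/
def TopPart {α : Type*} (k : ℕ) (score : α → ℝ) (full part : List α) : Prop :=
  ∃ rest, (part ++ rest).Perm full ∧
    ∀ y ∈ rest, k ≤ part.countP fun x => decide (score y ≤ score x)

theorem topPart_refl {α : Type*} (k : ℕ) (score : α → ℝ) (full : List α) :
    TopPart k score full full :=
  ⟨[], by rw [List.append_nil], fun _ hy => absurd hy List.not_mem_nil⟩

theorem TopPart.append {α : Type*} {k : ℕ} {score : α → ℝ} {full full' part part' : List α}
    (h : TopPart k score full part) (h' : TopPart k score full' part') :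
    TopPart k score (full ++ full') (part ++ part') := by
  obtain ⟨rest, hp, hr⟩ := h
  obtain ⟨rest', hp', hr'⟩ := h'
  refine ⟨rest ++ rest', ?_, fun y hy => ?_⟩
  · refine List.Perm.trans ?_ (hp.append hp')
    simp only [List.append_assoc]
    refine List.Perm.append_left part ?_
    simp only [← List.append_assoc]
    exact List.perm_append_comm.append_right rest'
  · rw [List.countP_append]
    rcases List.mem_append.1 hy with hy | hy
    · exact (hr y hy).trans (Nat.le_add_right _ _)
    · exact (hr' y hy).trans (Nat.le_add_left _ _)

/-- A best entry dominates every entry left out and so raises each domination count by one. -/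
theorem TopPart.cons {α : Type*} {k : ℕ} {score : α → ℝ} {full full' part : List α} {x : α}
    (h : TopPart k score full part) (hfull : full'.Perm (x :: full))
    (hx : ∀ y ∈ full, score y ≤ score x) : TopPart (k + 1) score full' (x :: part) := by
  obtain ⟨rest, hp, hr⟩ := h
  refine ⟨rest, (hp.cons x).trans hfull.symm, fun y hy => ?_⟩
  rw [List.countP_cons_of_pos (by
    simpa using hx y (hp.subset (List.mem_append.2 (Or.inr hy))))]
  exact Nat.succ_le_succ (hr y hy)

theorem TopPart.eq_nil {α : Type*} {k : ℕ} {score : α → ℝ} {part : List α}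
    (h : TopPart k score [] part) : part = [] := by
  obtain ⟨rest, hp, _⟩ := h
  exact (List.append_eq_nil_iff.1 hp.eq_nil).1

/-- Used for the ghost hit: finding nothing proves that there is nothing to find, as an omitted
entry would need a dominating one. -/
theorem TopPart.full_eq_nil {α : Type*} {k : ℕ} {score : α → ℝ} {full : List α}
    (h : TopPart k score full []) (hk : 1 ≤ k) : full = [] := by
  obtain ⟨rest, hp, hr⟩ := h
  rcases rest with _ | ⟨y, rest⟩
  · exact hp.symm.eq_nil
  · have := hr y (by simp)
    rw [List.countP_nil] at this
    omega

variable {n b : ℕ}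

/-- Suppose an omitted y beats a selected x. Entries dropped by the truncation score at most as much
as x, so they do not dominate y. The `lam` or more dominating entries then fill all selected places,
including that of x, a contradiction. -/
theorem TopPart.isBest_selectBest {lam l : ℕ} {D : Model b} {full part : List (Track n)}
    (h : TopPart lam (quality D l) full part) :
    IsBest lam (quality D l) full (selectBest lam D l part) := by
  obtain ⟨rest, hp, hr⟩ := h
  set sorted := part.mergeSort fun t u => decide (quality D l u ≤ quality D l t) with hsorted
  have hperm : sorted.Perm part := List.mergeSort_perm _ _
  have hpw : sorted.Pairwise fun x y => quality D l y ≤ quality D l x := by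
    have := List.pairwise_mergeSort (le := fun t u => decide (quality D l u ≤ quality D l t))
      (fun a b c hab hbc => by
        simp only [decide_eq_true_eq] at *
        exact hbc.trans hab)
      (fun a b => by
        simp only [Bool.or_eq_true, decide_eq_true_eq]
        exact le_total _ _) part
    simpa using this
  have hsplit : sorted.take lam ++ sorted.drop lam = sorted := List.take_append_drop _ _
  have hpw' := hpw
  rw [← hsplit, List.pairwise_append] at hpw'
  have hsel : selectBest lam D l part = sorted.take lam := rfl
  rw [hsel]
  refine ⟨sorted.drop lam ++ rest, ?_, ?_, hpw'.1, fun x hx y hy => ?_⟩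
  · rw [← List.append_assoc, hsplit]
    exact (hperm.append_right rest).trans hp
  · rw [List.length_take, hperm.length_eq, ← hp.length_eq, List.length_append]
    -- An omitted entry forces `part` to have at least `lam` entries, so both minima are `lam`.
    rcases rest with _ | ⟨y, rest⟩
    · simp
    · have := (hr y (by simp)).trans List.countP_le_length
      omega
  · rcases List.mem_append.1 hy with hy | hy
    · exact hpw'.2.2 x hx y hy
    · by_contra hc
      push Not at hc
      have h1 := hr y hy
      have h2 : (sorted.drop lam).countP (fun x => decide (quality D l y ≤ quality D l x)) = 0 := by
        rw [List.countP_eq_zero]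
        intro z hz
        simpa using (hpw'.2.2 x hx z hz).trans_lt hc
      rw [← hperm.countP_eq, ← hsplit, List.countP_append, h2, add_zero] at h1
      have h3 : (sorted.take lam).countP (fun x => decide (quality D l y ≤ quality D l x)) =
          (sorted.take lam).length :=
        le_antisymm List.countP_le_length (le_trans (List.length_take_le _ _) h1)
      have h4 := List.countP_eq_length.1 h3 x hx
      rw [decide_eq_true_eq] at h4
      exact absurd h4 (not_le.2 hc)

/-! ### The extensions of a track -/

/-- The extensions of `t` by hits with `χ² < χ₀²` that have not been used. -/
noncomputable def unusedExtensions (D : Model b) (ev : EventRecord n b) (l : ℕ) (t : Track n)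
    (used : List (Fin n)) : List (Track n) :=
  (List.finRange n).filterMap fun j =>
    if j ∈ used then none else
      match ev l j with
      | some v => if chi2 D l t v < D.chi0 then some (addHit D l t j v) else none
      | none => none

theorem unusedExtensions_nil (D : Model b) (ev : EventRecord n b) (l : ℕ) (t : Track n) :
    unusedExtensions D ev l t [] = goodExtensions D ev l t := by
  refine List.filterMap_congr fun j _ => ?_
  exact (if_neg List.not_mem_nil).trans (by rcases ev l j <;> rfl)

theorem mem_unusedExtensions (D : Model b) (ev : EventRecord n b) (l : ℕ) (t : Track n)
    (used : List (Fin n)) (u : Track n) :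
    u ∈ unusedExtensions D ev l t used ↔ ∃ j v, j ∉ used ∧ ev l j = some v ∧
      chi2 D l t v < D.chi0 ∧ u = addHit D l t j v := by
  unfold unusedExtensions
  rw [List.mem_filterMap]
  constructor
  · rintro ⟨j, _, h⟩
    split_ifs at h with hj
    rcases e : ev l j with _ | v
    · rw [e] at h; cases h
    · rw [e] at h
      dsimp only at h
      split_ifs at h with hc
      cases h
      exact ⟨j, v, hj, e, hc, rfl⟩
  · rintro ⟨j, v, hj, e, hc, rfl⟩
    exact ⟨j, List.mem_finRange j, by simp [hj, e, hc]⟩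

theorem unusedExtensions_perm (D : Model b) (ev : EventRecord n b) (l : ℕ) (t : Track n)
    (used : List (Fin n)) {j : Fin n} {v : Fin b → Bool} (hj : j ∉ used) (he : ev l j = some v)
    (hc : chi2 D l t v < D.chi0) :
    (unusedExtensions D ev l t used).Perm
      (addHit D l t j v :: unusedExtensions D ev l t (j :: used)) := by
  have hp : (List.finRange n).Perm (j :: (List.finRange n).erase j) :=
    List.perm_cons_erase (List.mem_finRange j)
  have hnd : j ∉ (List.finRange n).erase j :=
    (List.nodup_cons.1 (hp.nodup_iff.1 (List.nodup_finRange n))).1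
  refine (hp.filterMap _).trans ?_
  rw [List.filterMap_cons_some (b := addHit D l t j v) (by simp [hj, he, hc])]
  refine List.Perm.cons _ ?_
  refine List.Perm.trans ?_ (hp.filterMap _).symm
  rw [List.filterMap_cons_none (by simp)]
  refine List.Perm.of_eq (List.filterMap_congr fun i hi => ?_)
  have : i ≠ j := fun e => hnd (e ▸ hi)
  simp [this]

/-- Since n ≤ N, the binary digits of a label form an address. -/
theorem exists_hitAt (ev : EventRecord n b) (l : ℕ) {used : List (Fin n)} {j : Fin n}
    {v : Fin b → Bool} (hj : j ∉ used) (he : ev l j = some v) :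
    ∃ a, hitAt ev l used a = some (j, v) := by
  have hlt : (j : ℕ) < 2 ^ addrBits n :=
    j.2.trans_le (Nat.le_pow_clog (by norm_num) n)
  have h : Nat.ofBits (fun i : Fin (addrBits n) => (j : ℕ).testBit i) = j := by
    rw [Nat.ofBits_testBit, Nat.mod_eq_of_lt hlt]
  refine ⟨fun i => (j : ℕ).testBit i, ?_⟩
  unfold hitAt
  simp [h, hj, he]

theorem hitAt_eq_some (ev : EventRecord n b) (l : ℕ) {used : List (Fin n)}
    {a : Fin (addrBits n) → Bool} {h : Fin n × (Fin b → Bool)}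
    (ha : hitAt ev l used a = some h) : h.1 ∉ used ∧ ev l h.1 = some h.2 := by
  unfold hitAt at ha
  split_ifs at ha with h1 h2
  rw [Option.map_eq_some_iff] at ha
  obtain ⟨v, hv, rfl⟩ := ha
  exact ⟨h2, hv⟩

theorem quality_addHit_le (D : Model b) (l : ℕ) (t : Track n) {j j' : Fin n}
    {v v' : Fin b → Bool} (h : chi2 D l t v ≤ chi2 D l t v') :
    quality D l (addHit D l t j' v') ≤ quality D l (addHit D l t j v) := by
  have := mul_le_mul_of_nonneg_left h D.omega_nonneg
  simp only [quality, addHit]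
  linarith

theorem unusedExtensions_eq_nil {D : Model b} {ev : EventRecord n b} {l : ℕ} {t : Track n}
    {used : List (Fin n)} (h : IsMinimum D ev l t used none) :
    unusedExtensions D ev l t used = [] := by
  rw [List.eq_nil_iff_forall_not_mem]
  intro u hu
  obtain ⟨j, v, hj, he, hc, -⟩ := (mem_unusedExtensions D ev l t used u).1 hu
  obtain ⟨a, ha⟩ := exists_hitAt ev l hj he
  obtain ⟨h', e, -⟩ := h.2 a _ ha hc
  cases e

/-- As ω ≥ 0 and the ghost number is the same, least χ² means greatest quality among the unused
extensions. -/
theorem IsMinimum.topPart_cons {D : Model b} {ev : EventRecord n b} {l : ℕ} {t : Track n}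
    {used : List (Fin n)} {h : Fin n × (Fin b → Bool)} (hmin : IsMinimum D ev l t used (some h))
    {i : ℕ} {ts : List (Track n)}
    (hts : TopPart i (quality D l) (unusedExtensions D ev l t (h.1 :: used)) ts) :
    TopPart (i + 1) (quality D l) (unusedExtensions D ev l t used)
      (addHit D l t h.1 h.2 :: ts) := by
  obtain ⟨⟨a, ha⟩, hc⟩ := hmin.1 h rfl
  obtain ⟨hu, he⟩ := hitAt_eq_some ev l ha
  refine hts.cons (unusedExtensions_perm D ev l t used hu he hc) fun y hy => ?_
  obtain ⟨j, v, hj, he', hc', rfl⟩ := (mem_unusedExtensions D ev l t _ y).1 hy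
  obtain ⟨a', ha'⟩ := exists_hitAt ev l (fun hm => hj (List.mem_cons_of_mem _ hm)) he'
  obtain ⟨h', e, hle⟩ := hmin.2 a' _ ha' hc'
  cases e
  exact quality_addHit_le D l t hle

/-! ### Failure probability of track finding -/

variable (L lam : ℕ) (D : Model b) (ev : EventRecord n b)

theorem failure_rounds_le (l : ℕ) (t : Track n) (i : ℕ) :
    ∀ used : List (Fin n), failure (rounds L lam D ev l t i used)
      (TopPart i (quality D l) (unusedExtensions D ev l t used)) ≤
        i * 2⁻¹ ^ repetitions L lam n := by
  induction i with
  | zero =>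
    intro used
    rw [rounds.eq_def]
    dsimp only
    rw [failure_pure_of]
    · exact zero_le
    · exact ⟨unusedExtensions D ev l t used, List.Perm.refl _, fun _ _ => Nat.zero_le _⟩
  | succ i ih =>
    intro used
    rw [rounds.eq_def]
    dsimp only
    have e : ((i + 1 : ℕ) : ℝ≥0∞) * 2⁻¹ ^ repetitions L lam n =
        2⁻¹ ^ repetitions L lam n + i * 2⁻¹ ^ repetitions L lam n := by
      push_cast; ring
    rw [e]
    refine (failure_bind_le (G := IsMinimum D ev l t used)
      (ε := i * 2⁻¹ ^ repetitions L lam n) fun r hr => ?_).trans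
      (add_le_add (failure_repeatedMinimum_le L D ev l t used _) le_rfl)
    rw [failure_tick_bind]
    rcases r with _ | h
    · dsimp only
      -- A correct answer `none` means that no unused extension is left, so the remaining rounds
      -- have an empty list to cover.
      refine le_trans (failure_mono _ fun ts hts => ?_) (ih used)
      rw [unusedExtensions_eq_nil hr] at hts ⊢
      rw [hts.eq_nil]
      exact topPart_refl _ _ _
    · dsimp only
      rw [failure_tick_bind]
      refine (failure_bind_le (ε := 0) fun ts hts => ?_).trans
        ((add_zero _).trans_le (ih (h.1 :: used)))
      rw [if_pos (hr.1 h rfl).2, failure_pure_of (hr.topPart_cons hts)]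

theorem failure_quantumExtensions_le (hlam : 1 ≤ lam) (l : ℕ) (t : Track n) :
    failure (quantumExtensions L lam D ev l t)
      (TopPart lam (quality D l) (extensions D ev l t)) ≤ lam * 2⁻¹ ^ repetitions L lam n := by
  rw [quantumExtensions.eq_def, failure_tick_bind]
  refine (failure_bind_le (ε := 0) fun ts hts => ?_).trans
    ((add_zero _).trans_le (failure_rounds_le L lam D ev l t lam []))
  rw [unusedExtensions_nil] at hts
  rcases ts with _ | ⟨u, ts⟩
  · dsimp only
    have h : extensions D ev l t = [addGhost D l t] := by
      simp only [extensions, hts.full_eq_nil hlam]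
    rw [failure_tick_bind, h, failure_pure_of (topPart_refl _ _ _)]
  · dsimp only
    have h : extensions D ev l t = goodExtensions D ev l t := by
      unfold extensions
      rcases e : goodExtensions D ev l t with _ | ⟨w, ws⟩
      · rw [e] at hts
        cases hts.eq_nil
      · rfl
    rw [h, failure_pure_of hts]

theorem failure_quantumPool_le (hlam : 1 ≤ lam) (l : ℕ) (cs : List (Track n)) :
    failure (quantumPool L lam D ev l cs)
      (TopPart lam (quality D l) (cs.flatMap (extensions D ev l))) ≤
        cs.length * (lam * 2⁻¹ ^ repetitions L lam n) := by
  induction cs with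
  | nil =>
    rw [quantumPool.eq_def]
    dsimp only
    rw [List.flatMap_nil, failure_pure_of (topPart_refl _ _ _)]
    exact zero_le
  | cons t cs ih =>
    rw [quantumPool.eq_def]
    dsimp only
    rw [List.length_cons, Nat.cast_succ, add_mul, one_mul, add_comm]
    refine (failure_bind_le fun us hus => ?_).trans
      (add_le_add (failure_quantumExtensions_le L lam D ev hlam l t) le_rfl)
    refine (failure_bind_le (ε := 0) fun vs hvs => ?_).trans ((add_zero _).trans_le ih)
    rw [List.flatMap_cons, failure_pure_of (hus.append hvs)]

/-- Truncation keeps the list at no more than λ tracks, so a layer involves at most λ² repeated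
minima. A correct pool need only be a `TopPart` of the classical one. -/
theorem failure_quantumPropagate_le (hlam : 1 ≤ lam) (ls : List ℕ) :
    ∀ cs : List (Track n), cs.length ≤ lam → failure (quantumPropagate L lam D ev ls cs)
      (Propagates lam D ev ls cs) ≤
        ls.length * (lam * (lam * 2⁻¹ ^ repetitions L lam n)) := by
  induction ls with
  | nil =>
    intro cs _
    rw [quantumPropagate.eq_def]
    dsimp only
    rw [failure_pure_of (show Propagates lam D ev [] cs cs from rfl)]
    exact zero_le
  | cons l ls ih =>
    intro cs hcs
    rw [quantumPropagate.eq_def]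
    dsimp only
    rw [List.length_cons, Nat.cast_succ, add_mul, one_mul, add_comm]
    refine (failure_bind_le fun pool hpool => ?_).trans
      (add_le_add ((failure_quantumPool_le L lam D ev hlam l cs).trans
        (mul_le_mul_left (Nat.cast_le.2 hcs) _)) le_rfl)
    rw [failure_tick_bind]
    refine le_trans (failure_mono _ fun out hout => ?_)
      (ih (selectBest lam D l pool) (List.length_take_le _ _))
    exact ⟨_, hpool.isBest_selectBest, hout⟩

theorem failure_quantumFindFor_le (hlam : 1 ≤ lam) (ss : List (Seed n b)) :
    failure (quantumFindFor L lam D ev ss) (IsOutputFor L lam D ev ss) ≤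
      ss.length * ((layers L).length * (lam * (lam * 2⁻¹ ^ repetitions L lam n))) := by
  induction ss with
  | nil =>
    rw [quantumFindFor.eq_def]
    dsimp only
    rw [failure_pure_of (show IsOutputFor L lam D ev [] [] from rfl)]
    exact zero_le
  | cons s ss ih =>
    rw [quantumFindFor.eq_def]
    dsimp only
    rw [List.length_cons, Nat.cast_succ, add_mul, one_mul, add_comm, failure_tick_bind]
    refine (failure_bind_le fun o₁ ho₁ => ?_).trans
      (add_le_add (failure_quantumPropagate_le L lam D ev hlam (layers L) [initTrack D s] hlam)
        le_rfl)
    rw [failure_tick_bind]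
    refine (failure_bind_le (ε := 0) fun o₂ ho₂ => ?_).trans ((add_zero _).trans_le ih)
    rw [failure_pure_of (show IsOutputFor L lam D ev (s :: ss) (o₁ ++ o₂) from
      ⟨o₁, o₂, ho₁, ho₂, rfl⟩)]

theorem length_flatMap_finRange_le {α : Type*} (f : Fin n → List α) (m : ℕ)
    (h : ∀ j, (f j).length ≤ m) : ((List.finRange n).flatMap f).length ≤ n * m := by
  rw [List.length_flatMap]
  refine (List.sum_le_card_nsmul _ m fun x hx => ?_).trans (by simp)
  obtain ⟨j, _, rfl⟩ := List.mem_map.1 hx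
  exact h j

theorem length_seeds_le : (seeds D ev).length ≤ n ^ 3 := by
  have e : n ^ 3 = n * (n * n) := by ring
  rw [e]
  refine length_flatMap_finRange_le _ _ fun j₀ => length_flatMap_finRange_le _ _ fun j₁ => ?_
  exact (List.length_filterMap_le _ _).trans (by simp)

theorem failure_quantumTrackFinding_le (hlam : 1 ≤ lam) :
    failure (quantumFindFor L lam D ev (seeds D ev)) (IsTrackFindingOutput L lam D ev) ≤ 2⁻¹ := by
  refine (failure_quantumFindFor_le L lam D ev hlam (seeds D ev)).trans ?_
  have hs := length_seeds_le D ev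
  rcases Nat.eq_zero_or_pos n with hn | hn
  · have : (seeds D ev).length = 0 := by subst hn; simpa using hs
    rw [this, Nat.cast_zero, zero_mul]
    exact zero_le
  · set r := repetitions L lam n with hr
    have hr2 : 3 * L * lam ^ 2 * n ^ 3 ≤ 2 ^ r := Nat.le_pow_clog (by norm_num) _
    have hlay : (layers L).length ≤ L := by simp [layers]
    -- The factor 3 in `repetitions` gives a total of 1/3, more than needed for 1/2.
    have hnat : (seeds D ev).length * ((layers L).length * (lam * lam)) * 2 ≤ 2 ^ r := by
      have h1 : (seeds D ev).length * ((layers L).length * (lam * lam)) ≤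
          n ^ 3 * (L * (lam * lam)) :=
        Nat.mul_le_mul hs (Nat.mul_le_mul_right _ hlay)
      nlinarith [Nat.zero_le (n ^ 3 * (L * (lam * lam)))]
    have e : ((seeds D ev).length : ℝ≥0∞) * ((layers L).length * (lam * (lam * 2⁻¹ ^ r))) =
        (((seeds D ev).length * ((layers L).length * (lam * lam)) : ℕ) : ℝ≥0∞) / 2 ^ r := by
      rw [div_eq_mul_inv, ENNReal.inv_pow]
      push_cast
      ring
    rw [e]
    refine ENNReal.div_le_of_le_mul ?_
    have h2 : (((seeds D ev).length * ((layers L).length * (lam * lam)) : ℕ) : ℝ≥0∞) * 2 ≤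
        2 ^ r := by exact_mod_cast hnat
    rw [mul_comm 2⁻¹, ← div_eq_mul_inv, ENNReal.le_div_iff_mul_le (by simp) (by simp)]
    exact h2

theorem half_le_quantumTrackFinding (hlam : 1 ≤ lam) :
    (1 / 2 : ℝ≥0∞) ≤ (quantumTrackFinding L lam D ev).toOuterMeasure
      {r | IsTrackFindingOutput L lam D ev r.1} := by
  set p := quantumTrackFinding L lam D ev with hp
  have hf : p.toOuterMeasure {r | ¬ IsTrackFindingOutput L lam D ev r.1} ≤ 2⁻¹ :=
    failure_quantumTrackFinding_le L lam D ev hlam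
  -- The good and the bad event cover everything, so subadditivity suffices.
  have h1 : (1 : ℝ≥0∞) ≤ p.toOuterMeasure {r | IsTrackFindingOutput L lam D ev r.1} + 2⁻¹ := by
    refine le_trans ?_ (add_le_add le_rfl hf)
    refine le_trans ?_ (MeasureTheory.measure_union_le _ _)
    rw [(PMF.toOuterMeasure_apply_eq_one_iff _ _).2]
    intro r _
    exact em _
  rw [one_div, ← ENNReal.one_sub_inv_two]
  exact tsub_le_iff_right.2 h1

end QTrack

namespace QTrack

/-! ### Running time of circuits -/

section Circuits

variable {q b : ℕ}

theorem Circuit.time_append (L : ℕ) (c d : Circuit q b) :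
    Circuit.time L (c ++ d) = Circuit.time L c + Circuit.time L d := by
  simp [Circuit.time]

theorem Circuit.time_of_forall (L : ℕ) (c : Circuit q b) (h : ∀ g ∈ c, Gate.time L g = 1) :
    Circuit.time L c = c.length := by
  unfold Circuit.time
  rw [List.map_congr_left h]
  simp

theorem time_ladder_le (L : ℕ) (us : List (Wire q b)) :
    ∀ (w : Wire q b) (as : List (Wire q b)),
      Circuit.time L (ladder w us as) ≤ 2 * us.length + 1 := by
  induction us with
  | nil => intro w as; simp [ladder, Circuit.time, Gate.time]
  | cons u us ih =>
    intro w as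
    rcases as with _ | ⟨a, as⟩
    · simp [ladder, Circuit.time]
    · have := ih a as
      simp only [ladder, Circuit.time_append, List.length_cons]
      have h1 : Circuit.time L [(Gate.CCX w u a : Gate q b)] = 1 := rfl
      omega

theorem time_phaseFlip_le (L : ℕ) (pattern : List (Wire q b × Bool)) :
    Circuit.time L (phaseFlip pattern) ≤ 4 * pattern.length + 3 := by
  unfold phaseFlip
  have h1 : Circuit.time L (((pattern.filter fun p => !p.2).map fun p => Gate.X p.1 :
      Circuit q b)) ≤ pattern.length := by
    rw [Circuit.time_of_forall]
    · rw [List.length_map]; exact List.length_filter_le _ _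
    · intro g hg
      obtain ⟨p, _, rfl⟩ := List.mem_map.1 hg
      rfl
  have h2 : Circuit.time L [(Gate.X (ancW q b 0) : Gate q b)] = 1 := rfl
  have h3 := time_ladder_le L (pattern.map Prod.fst) (ancW q b 0)
    ((List.finRange (q + b + 1)).map fun i => ancW q b i.succ)
  rw [List.length_map] at h3
  simp only [Circuit.time_append]
  omega

theorem time_hadamards (L : ℕ) : Circuit.time L (hadamards q b) = q := by
  rw [Circuit.time_of_forall]
  · simp [hadamards]
  · intro g hg
    obtain ⟨i, _, rfl⟩ := List.mem_map.1 hg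
    rfl

/-- There are at most 2^(b+1) words to flip, whatever the number of marked addresses; this makes the
final constant depend on b. -/
theorem time_oracle_le (L : ℕ) (marked : Finset (Fin (b + 1) → Bool)) :
    Circuit.time L (oracle q marked) ≤ 2 * accessTime L q + 2 ^ (b + 1) * (4 * b + 7) := by
  have h1 : Circuit.time L [(Gate.qram : Gate q b)] = accessTime L q := by
    simp [Circuit.time, Gate.time]
  have h2 : ∀ vs : List (Fin (b + 1) → Bool), Circuit.time L (vs.flatMap fun v =>
      (phaseFlip ((List.finRange (b + 1)).map fun i => (cellW q b i, v i)) : Circuit q b)) ≤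
      vs.length * (4 * b + 7) := by
    intro vs
    induction vs with
    | nil => simp [Circuit.time]
    | cons v vs ih =>
      rw [List.flatMap_cons, Circuit.time_append, List.length_cons, add_mul, one_mul, add_comm]
      refine add_le_add ih ((time_phaseFlip_le L _).trans ?_)
      simp only [List.length_map, List.length_finRange]
      omega
  have h3 : marked.card ≤ 2 ^ (b + 1) := by
    have := Finset.card_le_univ marked
    rwa [Fintype.card_fun, Fintype.card_bool, Fintype.card_fin] at this
  have h4 := (h2 marked.toList).trans
    (Nat.mul_le_mul_right (4 * b + 7) ((Finset.length_toList marked).trans_le h3))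
  unfold oracle
  rw [Circuit.time_append, Circuit.time_append, h1]
  omega

theorem time_diffusion_le (L : ℕ) : Circuit.time L (diffusion q b) ≤ 6 * q + 3 := by
  have := time_phaseFlip_le L ((List.finRange q).map fun i => (addrW q b i, false))
  simp only [List.length_map, List.length_finRange] at this
  unfold diffusion
  rw [Circuit.time_append, Circuit.time_append, time_hadamards]
  omega

theorem time_grover_le (L : ℕ) (marked : Finset (Fin (b + 1) → Bool)) (k : ℕ) :
    Circuit.time L (grover q marked k) ≤
      q + k * (2 * accessTime L q + 2 ^ (b + 1) * (4 * b + 7) + 6 * q + 3) := by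
  induction k with
  | zero =>
    simp only [grover, List.replicate_zero, List.flatten_nil, List.append_nil, time_hadamards]
    omega
  | succ k ih =>
    have e : Circuit.time L (grover q marked (k + 1)) =
        Circuit.time L (grover q marked k) +
          (Circuit.time L (oracle q marked) + Circuit.time L (diffusion q b)) := by
      simp only [grover, List.replicate_succ', List.flatten_append, List.flatten_singleton,
        Circuit.time_append]
      omega
    have h1 := time_oracle_le (q := q) L marked
    have h2 := time_diffusion_le (q := q) (b := b) L
    rw [e, add_mul, one_mul]
    omega

theorem accessTime_le (L q : ℕ) : accessTime L q ≤ L + q := by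
  unfold accessTime
  refine Nat.clog_le_of_le_pow ?_
  rw [pow_add]
  exact Nat.mul_le_mul_right _ Nat.lt_two_pow_self.le

end Circuits

/-! ### Running time of track finding -/

variable {n b : ℕ}

/-- A bound on the time of an attempt of minimum finding, per oracle call. -/
def callTime (L b q : ℕ) : ℕ := (3 * L + 2 ^ (b + 1) * (4 * b + 7) + 16) * (q + 1)

/-- The test counts as a call, and to it are charged the drawing of k, the initial superposition and
the memory access of the test. -/
theorem time_attempt_le (L q : ℕ) (marked : Finset (Fin (b + 1) → Bool)) (k : ℕ) :
    (q + 1) + (Circuit.time L (grover q marked k) + (accessTime L q + 1)) ≤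
      (k + 1) * callTime L b q := by
  have h1 := time_grover_le (q := q) L marked k
  have h2 := accessTime_le L q
  set E := 2 ^ (b + 1) * (4 * b + 7) with hE
  have h3 : 2 * accessTime L q + E + 6 * q + 3 ≤ callTime L b q := by
    unfold callTime
    rw [← hE]
    nlinarith [Nat.zero_le (L * q), Nat.zero_le (E * q)]
  have h4 : 2 * q + 2 + accessTime L q ≤ callTime L b q := by
    unfold callTime
    rw [← hE]
    nlinarith [Nat.zero_le (L * q), Nat.zero_le (E * q)]
  have h5 := Nat.mul_le_mul_left k h3
  rw [add_mul, one_mul]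
  omega

theorem iterationChoices_le (q s : ℕ) : iterationChoices q s ≤ ⌈√((2 : ℝ) ^ q)⌉₊ :=
  Nat.ceil_mono (min_le_right _ _)

section Surely

variable (L lam : ℕ) (D : Model b) (ev : EventRecord n b) (l : ℕ) (t : Track n)

/-- An attempt starts below the limit but may end above it; the extra ⌈√N⌉ calls cover the last
attempt. -/
theorem surely_time_minimumLoop (used : List (Fin n)) (m : ℕ) :
    ∀ (calls s : ℕ) (y : ℝ) (best : Option (Fin n × (Fin b → Bool))), callLimit n - calls = m →
      Surely (minimumLoop L D ev l t used calls s y best) fun _ k =>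
        k ≤ if calls < callLimit n then
          (callLimit n - calls + ⌈√((2 : ℝ) ^ addrBits n)⌉₊) * callTime L b (addrBits n)
        else 0 := by
  induction m using Nat.strong_induction_on with
  | _ m ih =>
  intro calls s y best hcm
  rw [minimumLoop.eq_def]
  set G := callTime L b (addrBits n) with hG
  set S := ⌈√((2 : ℝ) ^ addrBits n)⌉₊ with hS
  by_cases hc : calls < callLimit n
  · rw [dif_pos hc, if_pos hc]
    refine surely_bind (Q := fun k c => k + 1 ≤ S ∧ c = addrBits n + 1)
      (surely_uniform (iterationChoices_pos (addrBits n) s) _ fun i hi =>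
        ⟨le_trans hi (iterationChoices_le _ _), rfl⟩) ?_
    rintro k _ ⟨hk, rfl⟩
    refine surely_bind (Q := fun _ c => c = Circuit.time L (grover (addrBits n)
      (markedCells D l t y) k)) (surely_runCircuit L _ _ fun _ => rfl) ?_
    rintro a _ rfl
    refine surely_bind (Q := fun _ c => c = accessTime L (addrBits n) + 1)
      (surely_tick rfl) ?_
    rintro _ _ rfl
    have hnext : ∀ m', (m' ≤ if calls + k + 1 < callLimit n then
        (callLimit n - (calls + k + 1) + S) * G else 0) →
        (addrBits n + 1) + (Circuit.time L (grover (addrBits n) (markedCells D l t y) k) +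
          ((accessTime L (addrBits n) + 1) + m')) ≤ (callLimit n - calls + S) * G := by
      intro m' hm'
      have h1 := time_attempt_le L (addrBits n) (markedCells D l t y) k
      rw [← hG] at h1
      split_ifs at hm' with hlt
      · have e : callLimit n - calls + S = (k + 1) + (callLimit n - (calls + k + 1) + S) := by
          omega
        rw [e, add_mul]
        omega
      · have : (k + 1) * G ≤ (callLimit n - calls + S) * G :=
          Nat.mul_le_mul_right _ (by omega)
        omega
    rcases hitAt ev l used a with _ | h
    · exact (ih _ (by omega) (calls + k + 1) (s + 1) y best rfl).mono fun _ m' hm' =>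
        hnext m' hm'
    · dsimp only
      split_ifs
      · exact (ih _ (by omega) (calls + k + 1) 0 _ _ rfl).mono fun _ m' hm' => hnext m' hm'
      · exact (ih _ (by omega) (calls + k + 1) (s + 1) y best rfl).mono fun _ m' hm' =>
          hnext m' hm'
  · rw [dif_neg hc, if_neg hc]
    exact surely_pure le_rfl

/-- A bound on the time of minimum finding. -/
noncomputable def minimumTime (L b n : ℕ) : ℕ :=
  (callLimit n + ⌈√((2 : ℝ) ^ addrBits n)⌉₊) * callTime L b (addrBits n)

theorem surely_time_minimumFinding (used : List (Fin n)) :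
    Surely (minimumFinding L D ev l t used) fun _ k => k ≤ minimumTime L b n := by
  refine (surely_time_minimumLoop L D ev l t used _ 0 0 _ none rfl).mono fun _ k hk => ?_
  split_ifs at hk
  · exact hk
  · omega

theorem surely_time_repeatedMinimum (used : List (Fin n)) (i : ℕ) :
    Surely (repeatedMinimum L D ev l t used i) fun _ k => k ≤ i * (minimumTime L b n + 1) := by
  induction i with
  | zero => exact surely_pure (Nat.zero_le _)
  | succ i ih =>
    refine surely_bind (surely_time_minimumFinding L D ev l t used) fun r k hk => ?_
    refine surely_bind ih fun r' k' hk' => ?_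
    refine surely_bind (Q := fun _ c => c = 1) (surely_tick rfl) ?_
    rintro _ _ rfl
    refine surely_pure ?_
    rw [add_mul, one_mul]
    omega

/-- A bound on the time of a round. -/
noncomputable def roundTime (L lam b n : ℕ) : ℕ :=
  repetitions L lam n * (minimumTime L b n + 1) + 2 * accessTime L (addrBits n) + L + 1

theorem surely_time_rounds (i : ℕ) : ∀ used : List (Fin n),
    Surely (rounds L lam D ev l t i used) fun ts k =>
      ts.length ≤ i ∧ k ≤ i * roundTime L lam b n := by
  induction i with
  | zero =>
    intro used
    rw [rounds.eq_def]
    exact surely_pure ⟨le_rfl, Nat.zero_le _⟩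
  | succ i ih =>
    intro used
    rw [rounds.eq_def]
    dsimp only
    refine surely_bind (surely_time_repeatedMinimum L D ev l t used _) fun r k hk => ?_
    refine surely_bind (Q := fun _ c => c = 1) (surely_tick rfl) ?_
    rintro _ _ rfl
    have hT : roundTime L lam b n = repetitions L lam n * (minimumTime L b n + 1) +
        2 * accessTime L (addrBits n) + L + 1 := rfl
    rw [add_mul, one_mul]
    rcases r with _ | h
    · exact (ih used).mono fun ts k' hk' => ⟨hk'.1.trans (Nat.le_succ i), by omega⟩
    · refine surely_bind (Q := fun _ c => c = 2 * accessTime L (addrBits n) + L)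
        (surely_tick rfl) ?_
      rintro _ _ rfl
      refine surely_bind (ih _) fun ts k' hk' => ?_
      split_ifs
      · exact surely_pure ⟨Nat.succ_le_succ hk'.1, by omega⟩
      · exact surely_pure ⟨hk'.1.trans (Nat.le_succ i), by omega⟩

/-- A bound on the time spent on a track at a layer. -/
noncomputable def extensionTime (L lam b n : ℕ) : ℕ := 1 + L + lam * roundTime L lam b n

theorem surely_time_quantumExtensions (hlam : 1 ≤ lam) :
    Surely (quantumExtensions L lam D ev l t) fun ts k =>
      ts.length ≤ lam ∧ k ≤ extensionTime L lam b n := by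
  rw [quantumExtensions.eq_def]
  refine surely_bind (Q := fun _ c => c = 1) (surely_tick rfl) ?_
  rintro _ _ rfl
  refine surely_bind (surely_time_rounds L lam D ev l t lam []) fun ts k hk => ?_
  have hT : extensionTime L lam b n = 1 + L + lam * roundTime L lam b n := rfl
  rcases ts with _ | ⟨u, ts⟩
  · refine surely_bind (Q := fun _ c => c = L) (surely_tick rfl) ?_
    rintro _ _ rfl
    exact surely_pure ⟨hlam, by omega⟩
  · exact surely_pure ⟨hk.1, by omega⟩

theorem surely_time_quantumPool (hlam : 1 ≤ lam) (cs : List (Track n)) :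
    Surely (quantumPool L lam D ev l cs) fun ts k =>
      ts.length ≤ cs.length * lam ∧ k ≤ cs.length * extensionTime L lam b n := by
  induction cs with
  | nil =>
    rw [quantumPool.eq_def]
    exact surely_pure ⟨Nat.zero_le _, Nat.zero_le _⟩
  | cons t cs ih =>
    rw [quantumPool.eq_def]
    dsimp only
    refine surely_bind (surely_time_quantumExtensions L lam D ev l t hlam) fun us k hk => ?_
    refine surely_bind ih fun vs k' hk' => ?_
    refine surely_pure ?_
    rw [List.length_append, List.length_cons, add_mul, one_mul, add_mul, one_mul]
    omega

/-- A bound on the time spent on a layer. -/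
noncomputable def layerTime (L lam b n : ℕ) : ℕ :=
  lam * extensionTime L lam b n + (lam * lam) ^ 2 + 1

theorem surely_time_quantumPropagate (hlam : 1 ≤ lam) (ls : List ℕ) :
    ∀ cs : List (Track n), cs.length ≤ lam →
      Surely (quantumPropagate L lam D ev ls cs) fun ts k =>
        ts.length ≤ lam ∧ k ≤ ls.length * layerTime L lam b n := by
  induction ls with
  | nil =>
    intro cs hcs
    rw [quantumPropagate.eq_def]
    exact surely_pure ⟨hcs, Nat.zero_le _⟩
  | cons l ls ih =>
    intro cs hcs
    rw [quantumPropagate.eq_def]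
    dsimp only
    refine surely_bind (surely_time_quantumPool L lam D ev l hlam cs) fun pool k hk => ?_
    refine surely_bind (Q := fun _ c => c = pool.length ^ 2 + 1) (surely_tick rfl) ?_
    rintro _ _ rfl
    refine (ih _ (List.length_take_le _ _)).mono fun ts k' hk' => ⟨hk'.1, ?_⟩
    have h1 : pool.length ^ 2 ≤ (lam * lam) ^ 2 :=
      Nat.pow_le_pow_left (hk.1.trans (Nat.mul_le_mul_right _ hcs)) 2
    have h2 := hk.2.trans (Nat.mul_le_mul_right (extensionTime L lam b n) hcs)
    have h3 : layerTime L lam b n = lam * extensionTime L lam b n + (lam * lam) ^ 2 + 1 := rfl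
    rw [List.length_cons, add_mul, one_mul]
    omega

theorem surely_time_quantumFindFor (hlam : 1 ≤ lam) (ss : List (Seed n b)) :
    Surely (quantumFindFor L lam D ev ss) fun _ k =>
      k ≤ ss.length * (1 + lam + L * layerTime L lam b n) := by
  induction ss with
  | nil =>
    rw [quantumFindFor.eq_def]
    exact surely_pure (Nat.zero_le _)
  | cons s ss ih =>
    rw [quantumFindFor.eq_def]
    dsimp only
    refine surely_bind (Q := fun _ c => c = 1) (surely_tick rfl) ?_
    rintro _ _ rfl
    refine surely_bind (surely_time_quantumPropagate L lam D ev hlam (layers L)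
      [initTrack D s] hlam) fun o₁ k hk => ?_
    refine surely_bind (Q := fun _ c => c = o₁.length) (surely_tick rfl) ?_
    rintro _ _ rfl
    refine surely_bind ih fun o₂ k' hk' => ?_
    refine surely_pure ?_
    have h1 : (layers L).length * layerTime L lam b n ≤ L * layerTime L lam b n :=
      Nat.mul_le_mul_right _ (by simp [layers])
    rw [List.length_cons, add_mul, one_mul]
    omega

end Surely

/-! ### The asymptotic bound -/

theorem sqrt_two_pow_addrBits_le (hn : 2 ≤ n) : √((2 : ℝ) ^ addrBits n) ≤ 2 * √n := by
  have h1 : 2 ^ (addrBits n - 1) < n := Nat.pow_pred_clog_lt_self (by norm_num) (by omega)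
  have h2 : 0 < addrBits n := Nat.clog_pos (by norm_num) hn
  have h3 : 2 ^ addrBits n ≤ 2 * n := by
    have : addrBits n = (addrBits n - 1) + 1 := by omega
    rw [this, pow_succ]
    omega
  have h4 : (2 : ℝ) ^ addrBits n ≤ 2 * n := by exact_mod_cast h3
  rw [Real.sqrt_le_left (by positivity), mul_pow, Real.sq_sqrt (Nat.cast_nonneg n)]
  have : (0 : ℝ) ≤ n := Nat.cast_nonneg n
  linarith

theorem addrBits_add_one_le (hn : 2 ≤ n) : (addrBits n : ℝ) + 1 ≤ 5 * Real.log n := by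
  have h1 : 2 ^ (addrBits n - 1) < n := Nat.pow_pred_clog_lt_self (by norm_num) (by omega)
  have h2 : 0 < addrBits n := Nat.clog_pos (by norm_num) hn
  obtain ⟨p, hp⟩ : ∃ p, addrBits n = p + 1 := ⟨addrBits n - 1, by omega⟩
  rw [hp, Nat.add_sub_cancel] at h1
  have h3 : (2 : ℝ) ^ p ≤ n := by exact_mod_cast h1.le
  have h4 : p * Real.log 2 ≤ Real.log n := by
    rw [← Real.log_pow]
    exact Real.log_le_log (by positivity) h3
  have h5 : Real.log 2 ≤ Real.log n := Real.log_le_log (by norm_num) (by exact_mod_cast hn)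
  -- With q = p + 1, the bounds above give (p + 2) log 2 ≤ 3 log n, and 3/0.6 = 5.
  have h6 : (0.6 : ℝ) < Real.log 2 := by linarith [Real.log_two_gt_d9]
  have h7 : (0 : ℝ) ≤ p := Nat.cast_nonneg p
  rw [hp]
  push_cast
  nlinarith

/-- From 3Lλ² ≤ 2^(3Lλ²) and n ≤ N. -/
theorem repetitions_le (L lam : ℕ) : repetitions L lam n ≤
    (3 * L * lam ^ 2 + 3) * (addrBits n + 1) := by
  have h : repetitions L lam n ≤ 3 * L * lam ^ 2 + 3 * addrBits n := by
    refine Nat.clog_le_of_le_pow ?_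
    have e : 2 ^ (3 * L * lam ^ 2 + 3 * addrBits n) =
        2 ^ (3 * L * lam ^ 2) * (2 ^ addrBits n) ^ 3 := by ring
    rw [e]
    exact Nat.mul_le_mul Nat.lt_two_pow_self.le
      (Nat.pow_le_pow_left (Nat.le_pow_clog one_lt_two n) 3)
  nlinarith [Nat.zero_le (3 * L * lam ^ 2 * addrBits n)]

/-- The constant of the bound for the time of a round. -/
def roundConst (L lam b : ℕ) : ℝ :=
  (3 * L * lam ^ 2 + 3) * (52 * (3 * L + 2 ^ (b + 1) * (4 * b + 7) + 16) + 1) + 3 * L + 4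

theorem roundTime_le (L lam b : ℕ) (hn : 2 ≤ n) : (roundTime L lam b n : ℝ) ≤
    roundConst L lam b * (√n * ((addrBits n : ℝ) + 1) ^ 2) := by
  set Q : ℝ := (addrBits n : ℝ) + 1 with hQ
  set X : ℝ := √n with hX
  set K : ℝ := 3 * L + 2 ^ (b + 1) * (4 * b + 7) + 16 with hK
  set A : ℝ := 3 * L * lam ^ 2 + 3 with hA
  have hQ1 : 1 ≤ Q := by
    have : (0 : ℝ) ≤ addrBits n := Nat.cast_nonneg _
    linarith
  have hX1 : 1 ≤ X := Real.one_le_sqrt.2 (by exact_mod_cast (by omega : 1 ≤ n))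
  have hK0 : 0 ≤ K := by positivity
  have hA0 : 0 ≤ A := by positivity
  have hN := sqrt_two_pow_addrBits_le hn
  have hN1 := one_le_sqrt_two_pow (addrBits n)
  have h1 : (callLimit n : ℝ) ≤ 24 * √(2 ^ addrBits n) := by
    have := (Nat.ceil_lt_add_one (by positivity :
      (0 : ℝ) ≤ 22.5 * Real.sqrt (2 ^ addrBits n))).le
    unfold callLimit
    linarith
  have h2 : (⌈√((2 : ℝ) ^ addrBits n)⌉₊ : ℝ) ≤ 2 * √(2 ^ addrBits n) := by
    have := (Nat.ceil_lt_add_one (Real.sqrt_nonneg ((2 : ℝ) ^ addrBits n))).le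
    linarith
  -- At most 24√N + 2√N calls are charged, and √N ≤ 2√n gives 52√n.
  have h3 : (minimumTime L b n : ℝ) ≤ 52 * X * (K * Q) := by
    have e : (minimumTime L b n : ℝ) =
        (callLimit n + ⌈√((2 : ℝ) ^ addrBits n)⌉₊) * (K * Q) := by
      simp only [minimumTime, callTime, hK, hQ]
      push_cast
      ring
    rw [e]
    exact mul_le_mul_of_nonneg_right (by linarith) (by positivity)
  have h4 : (repetitions L lam n : ℝ) ≤ A * Q := by
    have := repetitions_le (n := n) L lam
    rw [hA, hQ]
    exact_mod_cast this
  have h5 : (accessTime L (addrBits n) : ℝ) ≤ L + Q := by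
    have : (accessTime L (addrBits n) : ℝ) ≤ L + addrBits n := by
      exact_mod_cast accessTime_le L (addrBits n)
    linarith
  have hXQ : 1 ≤ X * Q ^ 2 := one_le_mul_of_one_le_of_one_le hX1 (one_le_pow₀ hQ1)
  have hXQ1 : Q ≤ X * Q ^ 2 := by nlinarith [mul_le_mul hX1 hQ1 zero_le_one (by linarith)]
  have h6 : (repetitions L lam n : ℝ) * (minimumTime L b n + 1) ≤
      A * Q * (52 * X * (K * Q) + 1) :=
    mul_le_mul h4 (by linarith) (by positivity) (by positivity)
  have e : (roundTime L lam b n : ℝ) = repetitions L lam n * (minimumTime L b n + 1) +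
      2 * accessTime L (addrBits n) + L + 1 := by
    simp only [roundTime]
    push_cast
    ring
  have h7 : A * Q ≤ A * (X * Q ^ 2) := mul_le_mul_of_nonneg_left hXQ1 hA0
  have h8 : (L : ℝ) ≤ L * (X * Q ^ 2) := le_mul_of_one_le_right (Nat.cast_nonneg L) hXQ
  have e' : roundConst L lam b * (X * Q ^ 2) = A * Q * (52 * X * (K * Q)) + A * (X * Q ^ 2) +
      3 * (L * (X * Q ^ 2)) + 4 * (X * Q ^ 2) := by
    rw [roundConst, ← hA, ← hK]; ring
  rw [e, e']
  linarith

/-- The constant of the bound for the time spent on a seed. -/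
def seedConst (L lam b : ℕ) : ℝ :=
  1 + lam + L * (lam * (1 + L + lam * roundConst L lam b) + (lam * lam) ^ 2 + 1)

theorem seedTime_le (L lam b : ℕ) (hn : 2 ≤ n) :
    ((1 + lam + L * layerTime L lam b n : ℕ) : ℝ) ≤
      seedConst L lam b * (√n * ((addrBits n : ℝ) + 1) ^ 2) := by
  have h := roundTime_le L lam b hn
  set Y : ℝ := √n * ((addrBits n : ℝ) + 1) ^ 2 with hY
  have hY1 : 1 ≤ Y := by
    refine one_le_mul_of_one_le_of_one_le
      (Real.one_le_sqrt.2 (by exact_mod_cast (by omega : 1 ≤ n))) (one_le_pow₀ ?_)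
    have : (0 : ℝ) ≤ addrBits n := Nat.cast_nonneg _
    linarith
  have hl : (0 : ℝ) ≤ lam := Nat.cast_nonneg lam
  have hL : (0 : ℝ) ≤ L := Nat.cast_nonneg L
  have h1 : (extensionTime L lam b n : ℝ) ≤ (1 + L + lam * roundConst L lam b) * Y := by
    simp only [extensionTime]
    push_cast
    have := mul_le_mul_of_nonneg_left h hl
    have := le_mul_of_one_le_right (by linarith : (0 : ℝ) ≤ 1 + L) hY1
    linarith
  have h2 : (layerTime L lam b n : ℝ) ≤
      (lam * (1 + L + lam * roundConst L lam b) + (lam * lam) ^ 2 + 1) * Y := by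
    simp only [layerTime]
    push_cast
    have := mul_le_mul_of_nonneg_left h1 hl
    have := le_mul_of_one_le_right (by positivity : (0 : ℝ) ≤ (lam * lam) ^ 2 + 1) hY1
    linarith
  rw [seedConst]
  push_cast
  have := mul_le_mul_of_nonneg_left h2 hL
  have := le_mul_of_one_le_right (by linarith : (0 : ℝ) ≤ 1 + lam) hY1
  linarith

theorem quantumTrackFinding_time_le (L lam : ℕ) (hlam : 1 ≤ lam) (D : Model b)
    (ev : EventRecord n b) (hn : 2 ≤ n) (r : List (Track n) × ℕ)
    (hr : r ∈ (quantumTrackFinding L lam D ev).support) :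
    (r.2 : ℝ) ≤ 25 * seedConst L lam b * ((seeds D ev).length * √n) * Real.log n ^ 2 := by
  have h1 : r.2 ≤ (seeds D ev).length * (1 + lam + L * layerTime L lam b n) :=
    surely_time_quantumFindFor L lam D ev hlam (seeds D ev) r hr
  have h2 : (r.2 : ℝ) ≤
      (seeds D ev).length * ((1 + lam + L * layerTime L lam b n : ℕ) : ℝ) := by
    exact_mod_cast h1
  have hc : 0 ≤ seedConst L lam b := by
    unfold seedConst roundConst
    positivity
  have h3 : ((addrBits n : ℝ) + 1) ^ 2 ≤ (5 * Real.log n) ^ 2 :=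
    pow_le_pow_left₀ (by positivity) (addrBits_add_one_le hn) 2
  have h4 : seedConst L lam b * (√n * ((addrBits n : ℝ) + 1) ^ 2) ≤
      seedConst L lam b * (√n * (5 * Real.log n) ^ 2) :=
    mul_le_mul_of_nonneg_left (mul_le_mul_of_nonneg_left h3 (Real.sqrt_nonneg _)) hc
  have h5 := mul_le_mul_of_nonneg_left ((seedTime_le L lam b hn).trans h4)
    (Nat.cast_nonneg (seeds D ev).length : (0 : ℝ) ≤ (seeds D ev).length)
  refine h2.trans (h5.trans (le_of_eq ?_))
  ring

end QTrack

theorem mainTheorem6 (L lam b : ℕ) (hL : 3 ≤ L) (hlam : 1 ≤ lam) :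
    ∃ (C : ℝ) (c : ℕ), ∀ (D : QTrack.Model b) (n : ℕ) (ev : QTrack.EventRecord n b),
      (1 / 2 : ENNReal) ≤ (QTrack.quantumTrackFinding L lam D ev).toOuterMeasure
        {r | QTrack.IsTrackFindingOutput L lam D ev r.1} ∧
      (2 ≤ n → ∀ r ∈ (QTrack.quantumTrackFinding L lam D ev).support,
        (r.2 : ℝ) ≤ C * ((QTrack.seeds D ev).length * Real.sqrt n) * Real.log n ^ c) := by
  -- One logarithm comes from the work per call and one from the repetitions; 25 is the square of
  -- the 5 in `addrBits_add_one_le`.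
  refine ⟨25 * QTrack.seedConst L lam b, 2, fun D n ev => ⟨?_, fun hn r hr => ?_⟩⟩
  · exact QTrack.half_le_quantumTrackFinding L lam D ev hlam
  · exact QTrack.quantumTrackFinding_time_le L lam hlam D ev hn r hr
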